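/- Let $m_1,m_2,n\ge 1$, $m=m_1+m_2$ and $j=\mathrm{diag}(I_{m_1},-I_{m_2})$. Let $\{A,S_0,\Pi_0\}$ be a strongly admissible triple (skew-self-adjoint case): $A,S_0$ are complex $n\times n$ matrices, $\Pi_0=[\vartheta_1\ \vartheta_2]$ is $n\times m$ with blocks $\vartheta_1$ ($n\times m_1$) and $\vartheta_2$ ($n\times m_2$), and $$S_0>0,\qquad AS_0-S_0A^*=\mathrm{i}\,\Pi_0\Pi_0^*,\qquad \mathrm{span}\bigcup_{k=0}^{n-1}\mathrm{Im}(A^k\vartheta_1)=\mathbb{C}^n,\qquad \mathrm{i}\notin\sigma(A).$$ Then $\det A\neq0$. For $k\ge0$ put $$\Pi_{k+1}=\Pi_k+\mathrm{i}A^{-1}\Pi_kj,\qquad S_{k+1}=S_k+A^{-1}S_k(A^*)^{-1}+A^{-1}\Pi_kj\Pi_k^*(A^*)^{-1},$$ $$C_k=j+\Pi_k^*S_k^{-1}\Pi_k-\Pi_{k+1}^*S_{k+1}^{-1}\Pi_{k+1}.$$ All $S_k$ are positive definite, and $C_k=U_k^*jU_k$ for some unitary $U_k$, so that $$y_{k+1}(z)=\Big(I_m+\frac{\mathrm{i}}{z}C_k\Big)y_k(z)\qquad(k=0,1,2,\dots)$$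 is a skew-self-adjoint discrete Dirac system. For every $z\in\mathbb{C}$ with $\Im z\ge0$, $z\ne0$, $z\neq\mathrm{i}$, this system has exactly one $m\times m_2$ matrix solution $Y_k(z)$ with $$Y_k(z)=\Big(1-\frac{\mathrm{i}}{z}\Big)^k\left(\begin{bmatrix}0\\ I_{m_2}\end{bmatrix}+o(1)\right),\qquad k\to\infty .$$ Put $A^\times=A-\mathrm{i}\,\vartheta_2\vartheta_2^*S_0^{-1}$. For such $z$ the matrix $[0\ \ I_{m_2}]Y_0(z)$ is invertible if and only if $zI_n+A^\times$ is invertible, and in that case the reflection coefficient $$\mathcal{R}(z)=[I_{m_1}\ \ 0]\,Y_0(z)\,\big([0\ \ I_{m_2}]\,Y_0(z)\big)^{-1}$$ is given by $$\mathcal{R}(z)=-\mathrm{i}\,\vartheta_1^*S_0^{-1}(zI_n+A^\times)^{-1}\vartheta_2 .$$ -/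

import Mathlib

open Matrix Filter Topology
open scoped ComplexOrder

noncomputable section

namespace SkewDirac

variable {m₁ m₂ n : ℕ}

/-- The signature matrix `j = diag(I_{m₁}, -I_{m₂})`. -/
def sigMat (m₁ m₂ : ℕ) : Matrix (Fin m₁ ⊕ Fin m₂) (Fin m₁ ⊕ Fin m₂) ℂ :=
  Matrix.fromBlocks 1 0 0 (-1)

/-- The pair `{A, B}` is controllable: the ranges of `B, A B, …, A^{n-1} B` together span `ℂⁿ`. -/
def Controllable (A : Matrix (Fin n) (Fin n) ℂ) (B : Matrix (Fin n) (Fin m₁) ℂ) : Prop :=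
  (⨆ k : Fin n, LinearMap.range (Matrix.toLin' (A ^ (k : ℕ) * B))) = ⊤

/-- Strongly admissible triples `{A, S₀, Π₀}` in the skew-self-adjoint case; `Π₀ = [ϑ₁ ϑ₂]`,
so that `ϑ₁ = Π₀.toCols₁` and `ϑ₂ = Π₀.toCols₂`. (Invertibility of `A` is a consequence.) -/
structure StronglyAdmissible (A S₀ : Matrix (Fin n) (Fin n) ℂ)
    (P₀ : Matrix (Fin n) (Fin m₁ ⊕ Fin m₂) ℂ) : Prop where
  posDef : S₀.PosDef
  identity : A * S₀ - S₀ * Aᴴ = Complex.I • (P₀ * P₀ᴴ)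
  controllable : Controllable A P₀.toCols₁
  not_mem_spectrum : Complex.I ∉ spectrum ℂ A

/-- The sequence `Π_{k+1} = Π_k + i A⁻¹ Π_k j`. -/
def piSeq (A : Matrix (Fin n) (Fin n) ℂ) (P₀ : Matrix (Fin n) (Fin m₁ ⊕ Fin m₂) ℂ) :
    ℕ → Matrix (Fin n) (Fin m₁ ⊕ Fin m₂) ℂ
  | 0 => P₀
  | k + 1 => piSeq A P₀ k + Complex.I • (A⁻¹ * piSeq A P₀ k * sigMat m₁ m₂)

/-- The sequence `S_{k+1} = S_k + A⁻¹ S_k (A*)⁻¹ + A⁻¹ Π_k j Π_k* (A*)⁻¹`. -/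
def sSeq (A S₀ : Matrix (Fin n) (Fin n) ℂ) (P₀ : Matrix (Fin n) (Fin m₁ ⊕ Fin m₂) ℂ) :
    ℕ → Matrix (Fin n) (Fin n) ℂ
  | 0 => S₀
  | k + 1 => sSeq A S₀ P₀ k + A⁻¹ * sSeq A S₀ P₀ k * (Aᴴ)⁻¹
      + A⁻¹ * piSeq A P₀ k * sigMat m₁ m₂ * (piSeq A P₀ k)ᴴ * (Aᴴ)⁻¹

/-- The potential determined by the triple:
`C_k = j + Π_k* S_k⁻¹ Π_k - Π_{k+1}* S_{k+1}⁻¹ Π_{k+1}`. -/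
def potential (A S₀ : Matrix (Fin n) (Fin n) ℂ) (P₀ : Matrix (Fin n) (Fin m₁ ⊕ Fin m₂) ℂ)
    (k : ℕ) : Matrix (Fin m₁ ⊕ Fin m₂) (Fin m₁ ⊕ Fin m₂) ℂ :=
  sigMat m₁ m₂ + (piSeq A P₀ k)ᴴ * (sSeq A S₀ P₀ k)⁻¹ * piSeq A P₀ k
    - (piSeq A P₀ (k + 1))ᴴ * (sSeq A S₀ P₀ (k + 1))⁻¹ * piSeq A P₀ (k + 1)

/-- `{C_k}` is the potential of a skew-self-adjoint discrete Dirac system: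
`C_k = U_k* j U_k` with unitary `U_k`. -/
def IsSkewDiracPotential (C : ℕ → Matrix (Fin m₁ ⊕ Fin m₂) (Fin m₁ ⊕ Fin m₂) ℂ) : Prop :=
  ∀ k, ∃ U ∈ Matrix.unitaryGroup (Fin m₁ ⊕ Fin m₂) ℂ, C k = Uᴴ * sigMat m₁ m₂ * U

/-- `Y` is an `m × m₂` matrix solution of `y_{k+1} = (I_m + (i/z) C_k) y_k` such that
`Y_k = (1 - i/z)^k ([0; I_{m₂}] + o(1))` as `k → ∞`. -/
structure IsJostSolution (C : ℕ → Matrix (Fin m₁ ⊕ Fin m₂) (Fin m₁ ⊕ Fin m₂) ℂ) (z : ℂ)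
    (Y : ℕ → Matrix (Fin m₁ ⊕ Fin m₂) (Fin m₂) ℂ) : Prop where
  system : ∀ k, Y (k + 1) = (1 + (Complex.I / z) • C k) * Y k
  asymptotics : ∃ ε : ℕ → Matrix (Fin m₁ ⊕ Fin m₂) (Fin m₂) ℂ, Tendsto ε atTop (𝓝 0) ∧
    ∀ k, Y k = (1 - Complex.I / z) ^ k • (Matrix.fromRows 0 1 + ε k)

/-- The reflection coefficient `[I 0] Y₀ ([0 I] Y₀)⁻¹` formed from the initial value `Y₀` of the
Jost solution (meaningful where `[0 I] Y₀` is invertible). -/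
def reflection (Y₀ : Matrix (Fin m₁ ⊕ Fin m₂) (Fin m₂) ℂ) : Matrix (Fin m₁) (Fin m₂) ℂ :=
  Y₀.toRows₁ * (Y₀.toRows₂)⁻¹

/-- `A^× = A - i ϑ₂ ϑ₂* S₀⁻¹`. -/
def crossMat (A S₀ : Matrix (Fin n) (Fin n) ℂ) (P₀ : Matrix (Fin n) (Fin m₁ ⊕ Fin m₂) ℂ) :
    Matrix (Fin n) (Fin n) ℂ :=
  A - Complex.I • (P₀.toCols₂ * P₀.toCols₂ᴴ * S₀⁻¹)

end SkewDirac

end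

/-!
Write `A` for the main matrix, `Q = 1 - i A⁻¹` and `T = (A - i)⁻¹ (A + i)`.

The operator identity and controllability place the spectrum of `A` in the open upper half-plane
(`StronglyAdmissible.im_neg`), so that `A` and `A + z`, `Im z ≥ 0`, are invertible. One step of the
recursion preserves the operator identity and satisfies the intertwining relation
`(A + A⁻¹) S = S' A* + i P' P*` (`IsStep.intertwine`). From these two relations everything algebraic
follows: the potential is an involution with the trace of `j`, hence unitarily similar to `j`
(`IsStep.potential_sq`, `IsStep.potential_trace`, `exists_unitary_of_involution`), and the Darboux
matrix `1 - i Π_k* S_k⁻¹ (A + z)⁻¹ Π_k` carries solutions of the free system, with potential `j`, to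
solutions of the system with potential `C_k` (`IsStep.darboux`).

Applied to the free solution `(1 - i/z)^k [0; 1]`, the Darboux matrix gives a Jost solution as soon
as `Π_k* S_k⁻¹ (A + z)⁻¹ Q^k ϑ₂ → 0`. Put `Π_k = Q^k Z_k` and `S_k = Q^k R_k Q^k*`. Then
`Z_k = [T^k ϑ₁, ϑ₂]`, and `R_k` increases by `2 X_k X_k*` with `X_k = (A - i)⁻¹ T^k ϑ₁`; this also
shows that `S_k > 0`. The expression above becomes `(R_k⁻¹ Z_k)* (A + z)⁻¹ ϑ₂`. Since `T` expands
and the pair `A, ϑ₁` is controllable, `X_k* v → 0` only for `v = 0`, hence `R_k⁻¹ → 0`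
(`tendsto_inv_of_unbounded`, `StronglyAdmissible.tendsto_rSeq_inv`). The identity
`A R_k - R_k A* = i Z_k Z_k*` then forces `R_k⁻¹ Z_k → 0`.

Uniqueness holds at every admissible `z`, including those where the Darboux matrix at `k = 0` is
singular: for `Im z ≥ 0` the matrix `1 + (i/z) C_k` is bounded below by `|1 - i/z|`
(`energy_step_ge`), so a solution that is `o(|1 - i/z|^k)` vanishes.

Finally, `[0 1] Y₀ = 1 - i ϑ₂* S₀⁻¹ (A + z)⁻¹ ϑ₂`, and the Weinstein–Aronszajn identity together
with `(z + A^×) (A + z)⁻¹ ϑ₂ = ϑ₂ [0 1] Y₀` gives the formula for the reflection coefficient.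
-/

noncomputable section

namespace SkewDirac

/-! ### One step of the recursion -/

section Step

variable {ι κ : Type*} [Fintype ι] [DecidableEq ι] [Fintype κ] [DecidableEq κ]

/-- One step `(S, P) ↦ (S', P')` of the recursion behind the potential, for a signature matrix `J`,
an operator identity `A S - S A* = i P P*` and `B = A⁻¹`. -/
structure IsStep (A B S S' : Matrix ι ι ℂ) (P P' : Matrix ι κ ℂ) (J : Matrix κ κ ℂ) : Prop where
  mul_inv : A * B = 1
  inv_mul : B * A = 1
  sq : J * J = 1
  star_sig : Jᴴ = J
  identity : A * S - S * Aᴴ = Complex.I • (P * Pᴴ)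
  next_P : P' = P + Complex.I • (B * P * J)
  next_S : S' = S + B * S * Bᴴ + B * P * J * Pᴴ * Bᴴ

namespace IsStep

variable {A B S S' : Matrix ι ι ℂ} {P P' : Matrix ι κ ℂ} {J : Matrix κ κ ℂ}

theorem star_mul_inv (h : IsStep A B S S' P P' J) : Aᴴ * Bᴴ = 1 := by
  rw [← conjTranspose_mul, h.inv_mul, conjTranspose_one]

theorem star_inv_mul (h : IsStep A B S S' P P' J) : Bᴴ * Aᴴ = 1 := by
  rw [← conjTranspose_mul, h.mul_inv, conjTranspose_one]

theorem mul_inv_cancel (h : IsStep A B S S' P P' J) {τ : Type*} (X : Matrix ι τ ℂ) :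
    A * (B * X) = X := by
  rw [← Matrix.mul_assoc, h.mul_inv, Matrix.one_mul]

theorem inv_mul_cancel (h : IsStep A B S S' P P' J) {τ : Type*} (X : Matrix ι τ ℂ) :
    B * (A * X) = X := by
  rw [← Matrix.mul_assoc, h.inv_mul, Matrix.one_mul]

theorem sig_cancel (h : IsStep A B S S' P P' J) {τ : Type*} (X : Matrix κ τ ℂ) :
    J * (J * X) = X := by
  rw [← Matrix.mul_assoc, h.sq, Matrix.one_mul]

/-- The operator identity is preserved by the recursion. -/
theorem identity_next (h : IsStep A B S S' P P' J) :
    A * S' - S' * Aᴴ = Complex.I • (P' * P'ᴴ) := by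
  have h1 := h.identity
  have h2 : B * (A * S - S * Aᴴ) * Bᴴ = B * (Complex.I • (P * Pᴴ)) * Bᴴ := by rw [h1]
  rw [h.next_P, h.next_S]
  simp only [Matrix.mul_add, Matrix.add_mul, Matrix.mul_sub, Matrix.sub_mul, Matrix.mul_assoc,
    smul_add, smul_smul, conjTranspose_add, conjTranspose_smul,
    conjTranspose_mul, h.star_sig, h.star_mul_inv, h.star_inv_mul, h.mul_inv_cancel,
    h.inv_mul_cancel, h.sig_cancel, Matrix.mul_one, Complex.star_def,
    Complex.conj_I, Matrix.smul_mul, Matrix.mul_smul] at h1 h2 ⊢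
  linear_combination (norm := skip) h1 + h2
  match_scalars <;> simp

/-- The relation between `S` and `S'` that, with the operator identity, carries the algebra of the
potential. -/
theorem intertwine (h : IsStep A B S S' P P' J) :
    (A + B) * S = S' * Aᴴ + Complex.I • (P' * Pᴴ) := by
  have h1 := h.identity
  rw [h.next_P, h.next_S]
  simp only [Matrix.add_mul, Matrix.mul_assoc, smul_add, smul_smul, h.star_inv_mul,
    Matrix.mul_one, Matrix.smul_mul] at h1 ⊢
  linear_combination (norm := skip) h1
  match_scalars <;> simp

/-- `S'` is a congruence transform of `S` plus a term that is positive semidefinite because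
`1 + J` is. -/
theorem next_S_eq (h : IsStep A B S S' P P' J) :
    S' = (1 - Complex.I • B) * S * (1 - Complex.I • B)ᴴ + B * P * (1 + J) * (B * P)ᴴ := by
  have h1 := h.identity
  have h2 : B * (A * S - S * Aᴴ) * Bᴴ = B * (Complex.I • (P * Pᴴ)) * Bᴴ := by rw [h1]
  rw [h.next_S]
  simp only [Matrix.mul_add, Matrix.add_mul, Matrix.mul_sub, Matrix.sub_mul, Matrix.mul_assoc,
    conjTranspose_sub, conjTranspose_smul, conjTranspose_one,
    conjTranspose_mul, h.star_mul_inv,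
    h.inv_mul_cancel, Matrix.mul_one, Matrix.one_mul, Complex.star_def,
    Complex.conj_I, Matrix.smul_mul, Matrix.mul_smul] at h2 ⊢
  linear_combination (norm := skip) (-Complex.I) • h2
  match_scalars <;> simp

section Inverse

variable {V V' : Matrix ι ι ℂ} {C : Matrix κ κ ℂ}

theorem inv_identity (h : IsStep A B S S' P P' J) (hSV : S * V = 1) (hVS : V * S = 1) :
    V * A - Aᴴ * V = Complex.I • (V * P * Pᴴ * V) := by
  have h2 : V * (A * S - S * Aᴴ) * V = V * (Complex.I • (P * Pᴴ)) * V := by rw [h.identity]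
  have hc : ∀ X : Matrix ι ι ℂ, V * (S * X) = X := fun X => by
    rw [← Matrix.mul_assoc, hVS, Matrix.one_mul]
  simpa only [Matrix.mul_sub, Matrix.sub_mul, Matrix.mul_assoc, hSV, hc, Matrix.mul_one,
    Matrix.smul_mul, Matrix.mul_smul] using h2

theorem inv_identity_next (h : IsStep A B S S' P P' J) (hSV : S' * V' = 1) (hVS : V' * S' = 1) :
    V' * A - Aᴴ * V' = Complex.I • (V' * P' * P'ᴴ * V') := by
  have h2 : V' * (A * S' - S' * Aᴴ) * V' = V' * (Complex.I • (P' * P'ᴴ)) * V' := by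
    rw [h.identity_next]
  have hc : ∀ X : Matrix ι ι ℂ, V' * (S' * X) = X := fun X => by
    rw [← Matrix.mul_assoc, hVS, Matrix.one_mul]
  simpa only [Matrix.mul_sub, Matrix.sub_mul, Matrix.mul_assoc, hSV, hc, Matrix.mul_one,
    Matrix.smul_mul, Matrix.mul_smul] using h2

theorem inv_intertwine (h : IsStep A B S S' P P' J) (hSV : S * V = 1) (hVS : V' * S' = 1) :
    V' * (A + B) = Aᴴ * V + Complex.I • (V' * P' * Pᴴ * V) := by
  have h2 : V' * ((A + B) * S) * V = V' * (S' * Aᴴ + Complex.I • (P' * Pᴴ)) * V := by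
    rw [h.intertwine]
  have hc : ∀ X : Matrix ι ι ℂ, V' * (S' * X) = X := fun X => by
    rw [← Matrix.mul_assoc, hVS, Matrix.one_mul]
  simpa only [Matrix.mul_add, Matrix.add_mul, Matrix.mul_assoc, hSV, hc, Matrix.mul_one,
    Matrix.smul_mul, Matrix.mul_smul] using h2

theorem inv_intertwine_star (h : IsStep A B S S' P P' J) (hSV : S * V = 1) (hVS : V' * S' = 1)
    (hV : Vᴴ = V) (hV' : V'ᴴ = V') :
    (Aᴴ + Bᴴ) * V' = V * A - Complex.I • (V * P * P'ᴴ * V') := by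
  have h2 := congrArg conjTranspose (h.inv_intertwine hSV hVS)
  simp only [conjTranspose_mul, conjTranspose_add, conjTranspose_smul, hV, hV', Complex.star_def,
    Complex.conj_I, conjTranspose_conjTranspose, ← Matrix.mul_assoc] at h2
  rw [h2]
  module

theorem star_next_P (h : IsStep A B S S' P P' J) : P'ᴴ = Pᴴ - Complex.I • (J * Pᴴ * Bᴴ) := by
  rw [h.next_P]
  simp only [conjTranspose_mul, conjTranspose_add, conjTranspose_smul, h.star_sig,
    Complex.star_def, Complex.conj_I, Matrix.mul_assoc]
  module

/-- How the potential `C` moves from `P* S⁻¹` to `P'* S'⁻¹`. -/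
theorem potential_mul (h : IsStep A B S S' P P' J) (hSV : S * V = 1) (hVS : V * S = 1)
    (hVS' : V' * S' = 1) (hC : C = J + Pᴴ * V * P - P'ᴴ * V' * P') :
    Complex.I • (C * Pᴴ * V) = Pᴴ * V * A - P'ᴴ * V' * (A + B) := by
  have e1 : P'ᴴ * (V' * (A + B)) = P'ᴴ * (Aᴴ * V + Complex.I • (V' * P' * Pᴴ * V)) := by
    rw [h.inv_intertwine hSV hVS']
  have e2 : Pᴴ * (V * A - Aᴴ * V) = Pᴴ * (Complex.I • (V * P * Pᴴ * V)) := by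
    rw [h.inv_identity hSV hVS]
  have e3 : P'ᴴ * Aᴴ * V = Pᴴ * Aᴴ * V - Complex.I • (J * Pᴴ * V) := by
    rw [h.star_next_P]
    simp only [Matrix.sub_mul, Matrix.mul_assoc, Matrix.smul_mul]
    rw [← Matrix.mul_assoc Bᴴ, h.star_inv_mul, Matrix.one_mul]
  rw [hC]
  simp only [Matrix.mul_add, Matrix.add_mul, Matrix.mul_sub, Matrix.sub_mul, Matrix.mul_assoc,
    smul_add, smul_sub, Matrix.mul_smul] at e1 e2 e3 ⊢
  linear_combination (norm := module) e1 - e2 + e3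

/-- The companion of `potential_mul` for `P'* S'⁻¹`; it uses that `S` and `S'` are Hermitian. -/
theorem potential_mul_next (h : IsStep A B S S' P P' J) (hSV : S * V = 1)
    (hSV' : S' * V' = 1) (hVS' : V' * S' = 1) (hV : Vᴴ = V) (hV' : V'ᴴ = V')
    (hC : C = J + Pᴴ * V * P - P'ᴴ * V' * P') :
    Complex.I • (C * P'ᴴ * V') = Pᴴ * V * A - P'ᴴ * V' * A := by
  have e1 : Pᴴ * ((Aᴴ + Bᴴ) * V') = Pᴴ * (V * A - Complex.I • (V * P * P'ᴴ * V')) := by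
    rw [h.inv_intertwine_star hSV hVS' hV hV']
  have e2 : P'ᴴ * (V' * A - Aᴴ * V') = P'ᴴ * (Complex.I • (V' * P' * P'ᴴ * V')) := by
    rw [h.inv_identity_next hSV' hVS']
  have e3 : Complex.I • (J * P'ᴴ * V') + P'ᴴ * Aᴴ * V' = Pᴴ * (Aᴴ + Bᴴ) * V' := by
    rw [h.star_next_P]
    simp only [Matrix.mul_add, Matrix.add_mul, Matrix.mul_sub, Matrix.sub_mul, Matrix.mul_assoc,
      Matrix.smul_mul, Matrix.mul_smul, h.sig_cancel, smul_sub, smul_smul]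
    rw [← Matrix.mul_assoc Bᴴ, h.star_inv_mul, Matrix.one_mul]
    match_scalars <;> simp
  rw [hC]
  simp only [Matrix.mul_add, Matrix.add_mul, Matrix.mul_sub, Matrix.sub_mul, Matrix.mul_assoc,
    smul_add, smul_sub, Matrix.mul_smul] at e1 e2 e3 ⊢
  linear_combination (norm := module) e1 + e2 + e3

/-- The potential is an involution: the last two lemmas give `C (C - J) = -(C - J) J`. -/
theorem potential_sq (h : IsStep A B S S' P P' J) (hSV : S * V = 1) (hVS : V * S = 1)
    (hSV' : S' * V' = 1) (hVS' : V' * S' = 1) (hV : Vᴴ = V) (hV' : V'ᴴ = V')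
    (hC : C = J + Pᴴ * V * P - P'ᴴ * V' * P') : C * C = 1 := by
  have e1 : Complex.I • (C * Pᴴ * V) * P = (Pᴴ * V * A - P'ᴴ * V' * (A + B)) * P := by
    rw [h.potential_mul hSV hVS hVS' hC]
  have e2 : Complex.I • (C * P'ᴴ * V') * P' = (Pᴴ * V * A - P'ᴴ * V' * A) * P' := by
    rw [h.potential_mul_next hSV hSV' hVS' hV hV' hC]
  have hAP : A * P' = A * P + Complex.I • (P * J) := by
    rw [h.next_P]
    simp only [Matrix.mul_add, Matrix.mul_smul, Matrix.mul_assoc, h.mul_inv_cancel]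
  have hBP : B * P = Complex.I • (P * J - P' * J) := by
    rw [h.next_P]
    simp only [Matrix.add_mul, Matrix.smul_mul, Matrix.mul_assoc, h.sq, Matrix.mul_one]
    match_scalars <;> simp
  have hCJ : C * (C - J) = J * J - C * J := by
    have hE : C - J = Pᴴ * V * P - P'ᴴ * V' * P' := by rw [hC]; abel
    have hI : Complex.I • (C * (C - J)) = Complex.I • (J * J - C * J) := by
      rw [← Matrix.sub_mul, ← neg_sub C J, hE]
      simp only [Matrix.mul_add, Matrix.add_mul, Matrix.mul_sub, Matrix.sub_mul, Matrix.mul_assoc,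
        smul_sub, Matrix.smul_mul, Matrix.mul_smul, hAP, hBP, Matrix.neg_mul]
        at e1 e2 ⊢
      linear_combination (norm := module) e1 - e2
    exact smul_right_injective _ Complex.I_ne_zero hI
  have h3 : C * C - C * J = 1 - C * J := by rw [← Matrix.mul_sub, hCJ, h.sq]
  simpa using h3

omit [DecidableEq κ] in
/-- The trace of `P* S⁻¹ P` is fixed by the operator identity. -/
theorem trace_eq (h : A * S - S * Aᴴ = Complex.I • (P * Pᴴ)) (hSV : S * V = 1)
    (hVS : V * S = 1) : Complex.I * (Pᴴ * V * P).trace = A.trace - Aᴴ.trace := by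
  rw [Matrix.trace_mul_comm, ← Matrix.mul_assoc, ← smul_eq_mul, ← Matrix.trace_smul,
    ← Matrix.smul_mul, ← h, Matrix.sub_mul, Matrix.trace_sub, Matrix.mul_assoc, hSV,
    Matrix.mul_one, Matrix.trace_mul_comm (S * Aᴴ), ← Matrix.mul_assoc, hVS, Matrix.one_mul]

theorem potential_trace (h : IsStep A B S S' P P' J) (hSV : S * V = 1) (hVS : V * S = 1)
    (hSV' : S' * V' = 1) (hVS' : V' * S' = 1)
    (hC : C = J + Pᴴ * V * P - P'ᴴ * V' * P') : C.trace = J.trace := by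
  have h1 := trace_eq h.identity hSV hVS
  have h2 := trace_eq h.identity_next hSV' hVS'
  have h3 := mul_left_cancel₀ Complex.I_ne_zero (h1.trans h2.symm)
  rw [hC, Matrix.trace_sub, Matrix.trace_add, h3, add_sub_cancel_right]

/-- The Darboux matrix `1 - i P* S⁻¹ (A + z)⁻¹ P` intertwines the system with potential `C` and the
system with constant potential `J`. -/
theorem darboux (h : IsStep A B S S' P P' J) (hSV : S * V = 1) (hVS : V * S = 1)
    (hVS' : V' * S' = 1) (hC : C = J + Pᴴ * V * P - P'ᴴ * V' * P') {z : ℂ} (hz : z ≠ 0)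
    {M : Matrix ι ι ℂ} (hM : M * (A + z • (1 : Matrix ι ι ℂ)) = 1)
    (hM' : (A + z • (1 : Matrix ι ι ℂ)) * M = 1) :
    (1 - Complex.I • (P'ᴴ * V' * M * P')) * (1 + (Complex.I / z) • J) =
      (1 + (Complex.I / z) • C) * (1 - Complex.I • (Pᴴ * V * M * P)) := by
  have hMA : M * A = 1 - z • M := by
    rw [← hM]; simp [Matrix.mul_add]
  have hAM : A * M = 1 - z • M := by
    rw [← hM']; simp [Matrix.add_mul]
  have hBM : B * M = M * B := by
    have : B * (A * M) * B = B * (M * A) * B := by rw [hMA, hAM]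
    rw [← Matrix.mul_assoc, h.inv_mul, Matrix.one_mul] at this
    rw [this, Matrix.mul_assoc, Matrix.mul_assoc, h.mul_inv, Matrix.mul_one]
  have e1 : Complex.I • (C * Pᴴ * V) * (M * P) =
      (Pᴴ * V * A - P'ᴴ * V' * (A + B)) * (M * P) := by
    rw [h.potential_mul hSV hVS hVS' hC]
  have hMP : M * P' * (z • (1 : Matrix κ κ ℂ) + Complex.I • J) =
      P' - (A + B) * (M * P) := by
    have h1 : M * P * J = A * (M * (B * P * J)) := by
      rw [← Matrix.mul_assoc A, hAM, ← hMA]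
      simp only [Matrix.mul_assoc, h.mul_inv_cancel]
    have h2 : M * (B * P) = B * (M * P) := by
      rw [← Matrix.mul_assoc, ← Matrix.mul_assoc, hBM]
    have h3 : A * (M * P) = P - z • (M * P) := by
      rw [← Matrix.mul_assoc, hAM, Matrix.sub_mul, Matrix.one_mul, Matrix.smul_mul]
    have h4 : M * P * J = B * (P * J) - z • (M * (B * (P * J))) := by
      rw [h1, ← Matrix.mul_assoc, hAM, Matrix.sub_mul, Matrix.one_mul, Matrix.smul_mul]
      simp only [Matrix.mul_assoc]
    rw [h.next_P]
    simp only [Matrix.mul_add, Matrix.add_mul, Matrix.smul_mul, Matrix.mul_smul, Matrix.mul_assoc,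
      Matrix.mul_one, h.sq, smul_add, smul_smul] at h4 ⊢
    rw [h3, ← h2, h4]
    match_scalars <;> simp
    ring
  have e2 : P'ᴴ * V' * (M * P' * (z • (1 : Matrix κ κ ℂ) + Complex.I • J)) =
      P'ᴴ * V' * (P' - (A + B) * (M * P)) := by rw [hMP]
  have hAMP : A * (M * P) = P - z • (M * P) := by
    rw [← Matrix.mul_assoc, hAM, Matrix.sub_mul, Matrix.one_mul, Matrix.smul_mul]
  have key : z • ((1 - Complex.I • (P'ᴴ * V' * M * P')) * (1 + (Complex.I / z) • J)) =
      z • ((1 + (Complex.I / z) • C) * (1 - Complex.I • (Pᴴ * V * M * P))) := by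
    simp only [Matrix.mul_add, Matrix.add_mul, Matrix.mul_sub, Matrix.sub_mul, Matrix.mul_assoc,
      Matrix.mul_one, Matrix.one_mul, hAMP,
      smul_add, smul_sub, smul_smul, Matrix.smul_mul, Matrix.mul_smul, mul_div_cancel₀ _ hz]
      at e1 e2 ⊢
    have hz' : z * (Complex.I / z) = Complex.I := by field_simp
    have hCe : C = J + Pᴴ * (V * P) - P'ᴴ * (V' * P') := by
      rw [hC]; simp only [Matrix.mul_assoc]
    linear_combination (norm := skip) Complex.I • e1 - Complex.I • e2 - Complex.I • hCe
    match_scalars <;> field_simp <;> simp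
  exact smul_right_injective _ hz key

end Inverse

end IsStep

end Step

/-! ### Hermitian involutions -/

section Signature

variable {κ : Type*} [Fintype κ] [DecidableEq κ]

/-- Hermitian matrices with equal characteristic polynomials are unitarily similar. -/
theorem exists_unitary_of_charpoly_eq {C J : Matrix κ κ ℂ} (hC : C.IsHermitian)
    (hJ : J.IsHermitian) (h : C.charpoly = J.charpoly) :
    ∃ U ∈ Matrix.unitaryGroup κ ℂ, C = Uᴴ * J * U := by
  have he := (hC.eigenvalues_eq_eigenvalues_iff (hB := hJ)).2 h
  have h1 := hC.spectral_theorem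
  have h2 := hJ.conjStarAlgAut_star_eigenvectorUnitary
  rw [he, ← h2] at h1
  refine ⟨_, (hJ.eigenvectorUnitary * star hC.eigenvectorUnitary).2, ?_⟩
  conv_lhs => rw [h1]
  simp only [Unitary.conjStarAlgAut_apply, ← Matrix.star_eq_conjTranspose]
  simp [mul_assoc]

open Polynomial in
/-- A Hermitian involution has eigenvalues `±1`, so that its trace determines their
multiplicities. -/
theorem charpoly_of_involution {C : Matrix κ κ ℂ} (hC : C.IsHermitian) (hsq : C * C = 1) :
    ∃ a b : ℕ, a + b = Fintype.card κ ∧ C.trace = a - b ∧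
      C.charpoly = (X - Polynomial.C 1) ^ a * (X - Polynomial.C (-1)) ^ b := by
  have hev : ∀ i, hC.eigenvalues i = 1 ∨ hC.eigenvalues i = -1 := by
    intro i
    have h2 := hC.conjStarAlgAut_star_eigenvectorUnitary
    have h3 := congrArg₂ (· * ·) h2 h2
    simp only [← map_mul, hsq, map_one, diagonal_mul_diagonal] at h3
    have h4 := congrFun (congrFun h3 i) i
    simp only [one_apply_eq, diagonal_apply_eq, Function.comp_apply] at h4
    have h5 : (1 : ℝ) = hC.eigenvalues i * hC.eigenvalues i := by
      have h6 : ((1 : ℝ) : ℂ) = ((hC.eigenvalues i * hC.eigenvalues i : ℝ) : ℂ) := by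
        push_cast; exact h4
      exact_mod_cast h6
    exact mul_self_eq_one_iff.1 h5.symm
  classical
  refine ⟨(Finset.univ.filter fun i => hC.eigenvalues i = 1).card,
    (Finset.univ.filter fun i => ¬ hC.eigenvalues i = 1).card, ?_, ?_, ?_⟩
  · exact Finset.card_filter_add_card_filter_not _
  · rw [hC.trace_eq_sum_eigenvalues,
      ← Finset.sum_filter_add_sum_filter_not _ fun i => hC.eigenvalues i = 1]
    rw [Finset.sum_congr rfl (g := fun _ => (1 : ℂ)) fun i hi => by
        simp [(Finset.mem_filter.1 hi).2],
      Finset.sum_congr (s₁ := Finset.univ.filter fun i => ¬ hC.eigenvalues i = 1) rfl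
        (g := fun _ => (-1 : ℂ)) fun i hi => by
        simp [(hev i).resolve_left (Finset.mem_filter.1 hi).2]]
    simp [sub_eq_add_neg]
  · rw [hC.charpoly_eq,
      ← Finset.prod_filter_mul_prod_filter_not _ fun i => hC.eigenvalues i = 1]
    rw [Finset.prod_congr rfl (g := fun _ => (X - Polynomial.C (1 : ℂ))) fun i hi => by
        simp [(Finset.mem_filter.1 hi).2],
      Finset.prod_congr (s₁ := Finset.univ.filter fun i => ¬ hC.eigenvalues i = 1) rfl
        (g := fun _ => (X - Polynomial.C (-1 : ℂ))) fun i hi => by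
        simp [(hev i).resolve_left (Finset.mem_filter.1 hi).2]]
    simp

theorem exists_unitary_of_involution {C J : Matrix κ κ ℂ} (hC : C.IsHermitian)
    (hJ : J.IsHermitian) (hCsq : C * C = 1) (hJsq : J * J = 1) (ht : C.trace = J.trace) :
    ∃ U ∈ Matrix.unitaryGroup κ ℂ, C = Uᴴ * J * U := by
  obtain ⟨a, b, h1, h2, h3⟩ := charpoly_of_involution hC hCsq
  obtain ⟨a', b', h1', h2', h3'⟩ := charpoly_of_involution hJ hJsq
  have h4 : (a : ℤ) - b = a' - b' := by
    have : ((a - b : ℤ) : ℂ) = ((a' - b' : ℤ) : ℂ) := by push_cast; rw [← h2, ← h2', ht]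
    exact_mod_cast this
  have ha : a = a' := by omega
  have hb : b = b' := by omega
  exact exists_unitary_of_charpoly_eq hC hJ (by rw [h3, h3', ha, hb])

end Signature

/-! ### The spectrum of the main matrix -/

section Spectrum

variable {m₁ m₂ n : ℕ}

/-- Hautus test: no eigenvector of `A*` is orthogonal to the range of `B`. -/
theorem Controllable.eq_zero {A : Matrix (Fin n) (Fin n) ℂ} {B : Matrix (Fin n) (Fin m₁) ℂ}
    (h : Controllable A B) {v : Fin n → ℂ} {μ : ℂ} (hv : Aᴴ *ᵥ v = μ • v) (hB : Bᴴ *ᵥ v = 0) :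
    v = 0 := by
  have hpow : ∀ k : ℕ, (Aᴴ ^ k) *ᵥ v = μ ^ k • v := by
    intro k
    induction k with
    | zero => simp
    | succ k ih => rw [pow_succ, ← mulVec_mulVec, hv, mulVec_smul, ih, smul_smul, pow_succ,
        mul_comm]
  have hle : (⨆ k : Fin n, LinearMap.range (Matrix.toLin' (A ^ (k : ℕ) * B))) ≤
      LinearMap.ker (dotProductBilin ℂ ℂ (star v)) := by
    refine iSup_le fun k => ?_
    rintro _ ⟨x, rfl⟩
    have h0 : (A ^ (k : ℕ) * B)ᴴ *ᵥ v = 0 := by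
      rw [conjTranspose_mul, conjTranspose_pow, ← mulVec_mulVec, hpow, mulVec_smul, hB, smul_zero]
    have h1 : star v ᵥ* (A ^ (k : ℕ) * B) = 0 := by
      rw [← conjTranspose_conjTranspose (A ^ (k : ℕ) * B), ← star_mulVec, h0, star_zero]
    rw [LinearMap.mem_ker]
    change star v ⬝ᵥ (toLin' (A ^ (k : ℕ) * B) x) = 0
    rw [toLin'_apply, dotProduct_mulVec, h1, zero_dotProduct]
  rw [h] at hle
  have h2 : v ∈ LinearMap.ker (dotProductBilin ℂ ℂ (star v)) := hle Submodule.mem_top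
  exact dotProduct_star_self_eq_zero.1 h2

variable {A S₀ : Matrix (Fin n) (Fin n) ℂ} {P₀ : Matrix (Fin n) (Fin m₁ ⊕ Fin m₂) ℂ}

/-- The spectrum of `A` lies in the open upper half-plane: the operator identity, evaluated at an
eigenvector `v` of `A*`, gives `-2 Im μ (v* S₀ v) = |Π₀* v|²`, and the Hautus test excludes
`Π₀* v = 0`. -/
theorem StronglyAdmissible.im_neg (h : StronglyAdmissible A S₀ P₀) {v : Fin n → ℂ} {μ : ℂ}
    (hv : Aᴴ *ᵥ v = μ • v) (h0 : v ≠ 0) : μ.im < 0 := by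
  have hpos := h.posDef.dotProduct_mulVec_pos h0
  have hvA : star v ᵥ* A = star μ • star v := by
    rw [← conjTranspose_conjTranspose A, ← star_mulVec, hv, star_smul]
  have h1 : star v ⬝ᵥ ((A * S₀ - S₀ * Aᴴ) *ᵥ v) =
      star v ⬝ᵥ ((Complex.I • (P₀ * P₀ᴴ)) *ᵥ v) := by rw [h.identity]
  have h2 : star v ⬝ᵥ ((P₀ * P₀ᴴ) *ᵥ v) = star (P₀ᴴ *ᵥ v) ⬝ᵥ (P₀ᴴ *ᵥ v) := by
    rw [star_mulVec, conjTranspose_conjTranspose, ← mulVec_mulVec, dotProduct_mulVec]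
  have hnn : 0 ≤ star (P₀ᴴ *ᵥ v) ⬝ᵥ (P₀ᴴ *ᵥ v) := dotProduct_star_self_nonneg _
  rw [sub_mulVec, dotProduct_sub, smul_mulVec, dotProduct_smul, h2, ← mulVec_mulVec,
    ← mulVec_mulVec, hv, dotProduct_mulVec _ A, hvA, smul_dotProduct, mulVec_smul,
    dotProduct_smul] at h1
  generalize hs : star v ⬝ᵥ (S₀ *ᵥ v) = s at h1 hpos
  generalize hp : star (P₀ᴴ *ᵥ v) ⬝ᵥ (P₀ᴴ *ᵥ v) = p at h1 hnn
  rw [Complex.lt_def] at hpos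
  rw [Complex.le_def] at hnn
  have h3 := congrArg Complex.im h1
  simp only [smul_eq_mul, Complex.sub_im, Complex.mul_im, Complex.star_def, Complex.conj_re,
    Complex.conj_im, Complex.I_re, Complex.I_im, Complex.zero_re, Complex.zero_im] at h3 hpos hnn
  rw [← hpos.2, ← hnn.2] at h3
  by_contra hcon
  push Not at hcon
  have hp0 : p.re = 0 := by nlinarith [mul_nonneg hcon hpos.1.le]
  have hp1 : p = 0 := Complex.ext hp0 hnn.2.symm
  rw [hp1] at hp
  have h4 : P₀ᴴ *ᵥ v = 0 := dotProduct_star_self_eq_zero.1 hp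
  refine h0 (h.controllable.eq_zero hv ?_)
  ext i
  exact congrFun h4 (Sum.inl i)

theorem StronglyAdmissible.isUnit_add_smul (h : StronglyAdmissible A S₀ P₀) {z : ℂ}
    (hz : 0 ≤ z.im) : IsUnit (A + z • (1 : Matrix (Fin n) (Fin n) ℂ)) := by
  rw [← isUnit_conjTranspose, Matrix.isUnit_iff_isUnit_det, isUnit_iff_ne_zero]
  intro hdet
  obtain ⟨v, hv0, hv⟩ := exists_mulVec_eq_zero_iff.2 hdet
  have h1 : Aᴴ *ᵥ v = (-star z) • v := by
    rw [conjTranspose_add, add_mulVec, conjTranspose_smul, conjTranspose_one, smul_mulVec,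
      one_mulVec] at hv
    rw [neg_smul]
    exact eq_neg_of_add_eq_zero_left hv
  have := h.im_neg h1 hv0
  simp at this
  linarith

theorem StronglyAdmissible.isUnit (h : StronglyAdmissible A S₀ P₀) : IsUnit A := by
  simpa using h.isUnit_add_smul (z := 0) (by simp)

theorem StronglyAdmissible.isUnit_sub_I (h : StronglyAdmissible A S₀ P₀) :
    IsUnit (A - Complex.I • (1 : Matrix (Fin n) (Fin n) ℂ)) := by
  have := h.not_mem_spectrum
  rw [spectrum.notMem_iff, Algebra.algebraMap_eq_smul_one] at this
  simpa using this.neg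

end Spectrum

/-! ### Inverses of increasing positive definite matrices -/

section QuadraticForms

variable {n : ℕ}

/-- The real quadratic form `w ↦ Re (w* M w)` of a matrix `M`. -/
def quadForm (M : Matrix (Fin n) (Fin n) ℂ) (w : Fin n → ℂ) : ℝ :=
  (star w ⬝ᵥ (M *ᵥ w)).re

theorem continuous_quadForm (M : Matrix (Fin n) (Fin n) ℂ) : Continuous (quadForm M) := by
  unfold quadForm
  fun_prop

theorem quadForm_smul (M : Matrix (Fin n) (Fin n) ℂ) (t : ℝ) (w : Fin n → ℂ) :
    quadForm M ((t : ℂ) • w) = t ^ 2 * quadForm M w := by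
  unfold quadForm
  rw [star_smul, mulVec_smul, smul_dotProduct, dotProduct_smul, smul_eq_mul, smul_eq_mul,
    Complex.star_def, Complex.conj_ofReal, Complex.re_ofReal_mul, Complex.re_ofReal_mul]
  ring

theorem re_star_dotProduct_self {ι : Type*} [Fintype ι] (y : ι → ℂ) :
    (star y ⬝ᵥ y).re = ∑ i, ‖y i‖ ^ 2 := by
  simp [dotProduct, ← Complex.normSq_eq_norm_sq, Complex.normSq_apply]

theorem exists_quadForm_ge {M : Matrix (Fin n) (Fin n) ℂ} (hM : M.PosDef) :
    ∃ c > 0, ∀ w, c * ‖w‖ ^ 2 ≤ quadForm M w := by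
  rcases (Metric.sphere (0 : Fin n → ℂ) 1).eq_empty_or_nonempty with he | hne
  · refine ⟨1, one_pos, fun w => ?_⟩
    have hw : w = 0 := by
      by_contra h
      have : ((‖w‖⁻¹ : ℝ) : ℂ) • w ∈ Metric.sphere (0 : Fin n → ℂ) 1 := by
        simp [norm_smul, h]
      rw [he] at this
      exact this
    simp [hw, quadForm]
  · obtain ⟨x, hx, hmin⟩ := (isCompact_sphere (0 : Fin n → ℂ) 1).exists_isMinOn hne
      (continuous_quadForm M).continuousOn
    have hx0 : x ≠ 0 := by
      rintro rfl
      simp at hx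
    refine ⟨quadForm M x, hM.re_dotProduct_pos hx0, fun w => ?_⟩
    by_cases h : w = 0
    · simp [h, quadForm]
    · have hw : ((‖w‖⁻¹ : ℝ) : ℂ) • w ∈ Metric.sphere (0 : Fin n → ℂ) 1 := by
        simp [norm_smul, h]
      have h1 := hmin hw
      simp only [Set.mem_ofPred_eq, quadForm_smul] at h1
      have h2 : 0 < ‖w‖ := norm_pos_iff.2 h
      rw [inv_pow, inv_mul_eq_div, le_div_iff₀ (by positivity)] at h1
      exact h1

theorem re_star_dotProduct_le (w u : Fin n → ℂ) :
    (star w ⬝ᵥ u).re ≤ ‖w‖ * ∑ i, ‖u i‖ := by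
  refine (Complex.re_le_norm _).trans ((norm_sum_le _ _).trans ?_)
  rw [Finset.mul_sum]
  refine Finset.sum_le_sum fun i _ => ?_
  rw [norm_mul, Pi.star_apply, norm_star]
  exact mul_le_mul_of_nonneg_right (norm_le_pi_norm w i) (norm_nonneg _)

/-- If the quadratic forms of positive definite matrices `R k` increase, and are unbounded at each
nonzero vector, then the inverses of the `R k` tend to zero: the vectors `(R k)⁻¹ u` are bounded,
and a cluster point `w` of them satisfies `w* (R l) w ≤ Re (w* u)` for every `l`. -/
theorem tendsto_inv_of_unbounded {R : ℕ → Matrix (Fin n) (Fin n) ℂ} (hR : ∀ k, (R k).PosDef)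
    (hmono : ∀ w, Monotone fun k => quadForm (R k) w)
    (hunb : ∀ w (c : ℝ), (∀ k, quadForm (R k) w ≤ c) → w = 0) :
    Tendsto (fun k => (R k)⁻¹) atTop (𝓝 0) := by
  have main : ∀ u : Fin n → ℂ, Tendsto (fun k => (R k)⁻¹ *ᵥ u) atTop (𝓝 0) := by
    intro u
    have hle : ∀ l k, l ≤ k → quadForm (R l) ((R k)⁻¹ *ᵥ u) ≤ (star ((R k)⁻¹ *ᵥ u) ⬝ᵥ u).re := by
      intro l k hlk
      refine (hmono _ hlk).trans ?_
      simp only [quadForm]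
      rw [mulVec_mulVec, mul_nonsing_inv _ ((Matrix.isUnit_iff_isUnit_det _).1 (hR k).isUnit),
        one_mulVec]
    obtain ⟨c, hc, hcw⟩ := exists_quadForm_ge (hR 0)
    refine (isCompact_closedBall (0 : Fin n → ℂ)
      ((∑ i, ‖u i‖) / c)).tendsto_nhds_of_unique_mapClusterPt (Eventually.of_forall fun k => ?_)
      fun w _ hw => ?_
    · rw [mem_closedBall_zero_iff, le_div_iff₀ hc]
      have h1 := (hcw _).trans ((hle 0 k k.zero_le).trans (re_star_dotProduct_le _ _))
      rcases (norm_nonneg ((R k)⁻¹ *ᵥ u)).eq_or_lt with h0 | h0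
      · rw [← h0, zero_mul]
        positivity
      · refine le_of_mul_le_mul_left ?_ h0
        linarith
    · refine hunb w (star w ⬝ᵥ u).re fun l => ?_
      have hcl : IsClosed {w : Fin n → ℂ | quadForm (R l) w ≤ (star w ⬝ᵥ u).re} :=
        isClosed_le (continuous_quadForm _) (by fun_prop)
      exact hcl.mem_of_mapClusterPt hw (eventually_atTop.2 ⟨l, fun k hk => hle l k hk⟩)
  refine tendsto_pi_nhds.2 fun i => tendsto_pi_nhds.2 fun j => ?_
  have := (tendsto_pi_nhds.1 (main (Pi.single j 1))) i
  simpa [mulVec_single_one] using this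

end QuadraticForms

/-! ### The normalized sequences -/

section Normalized

variable {m₁ m₂ n : ℕ}

/-- `X_k = (A - i)⁻¹ T^k ϑ₁`, where `T = (A - i)⁻¹ (A + i)`. The recursion is written with
`T = 1 + 2 i (A - i)⁻¹`. -/
def xSeq (A : Matrix (Fin n) (Fin n) ℂ) (P₀ : Matrix (Fin n) (Fin m₁ ⊕ Fin m₂) ℂ) :
    ℕ → Matrix (Fin n) (Fin m₁) ℂ
  | 0 => (A - Complex.I • (1 : Matrix (Fin n) (Fin n) ℂ))⁻¹ * P₀.toCols₁
  | k + 1 => xSeq A P₀ k +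
      (2 * Complex.I) • ((A - Complex.I • (1 : Matrix (Fin n) (Fin n) ℂ))⁻¹ * xSeq A P₀ k)

/-- `Q^{-k} Π_k = [T^k ϑ₁, ϑ₂]`, where `Q = 1 - i A⁻¹`; here `T^k ϑ₁ = (A - i) X_k`. -/
def zSeq (A : Matrix (Fin n) (Fin n) ℂ) (P₀ : Matrix (Fin n) (Fin m₁ ⊕ Fin m₂) ℂ) (k : ℕ) :
    Matrix (Fin n) (Fin m₁ ⊕ Fin m₂) ℂ :=
  fromCols ((A - Complex.I • (1 : Matrix (Fin n) (Fin n) ℂ)) * xSeq A P₀ k) P₀.toCols₂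

/-- `R_k = Q^{-k} S_k Q^{-k}*`, where `Q = 1 - i A⁻¹`, as an increasing sequence. -/
def rSeq (A S₀ : Matrix (Fin n) (Fin n) ℂ) (P₀ : Matrix (Fin n) (Fin m₁ ⊕ Fin m₂) ℂ) :
    ℕ → Matrix (Fin n) (Fin n) ℂ
  | 0 => S₀
  | k + 1 => rSeq A S₀ P₀ k + (2 : ℂ) • (xSeq A P₀ k * (xSeq A P₀ k)ᴴ)

theorem sigMat_mul_self : sigMat m₁ m₂ * sigMat m₁ m₂ = 1 := by
  simp [sigMat, fromBlocks_multiply]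

theorem sigMat_conjTranspose : (sigMat m₁ m₂)ᴴ = sigMat m₁ m₂ := by
  simp [sigMat, fromBlocks_conjTranspose]

variable {A S₀ : Matrix (Fin n) (Fin n) ℂ} {P₀ : Matrix (Fin n) (Fin m₁ ⊕ Fin m₂) ℂ}

namespace StronglyAdmissible

theorem identity_seq (h : StronglyAdmissible A S₀ P₀) (k : ℕ) :
    A * sSeq A S₀ P₀ k - sSeq A S₀ P₀ k * Aᴴ = Complex.I • (piSeq A P₀ k * (piSeq A P₀ k)ᴴ) ∧
    IsStep A A⁻¹ (sSeq A S₀ P₀ k) (sSeq A S₀ P₀ (k + 1)) (piSeq A P₀ k) (piSeq A P₀ (k + 1))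
      (sigMat m₁ m₂) := by
  have hA := (Matrix.isUnit_iff_isUnit_det A).1 h.isUnit
  have step : ∀ k, A * sSeq A S₀ P₀ k - sSeq A S₀ P₀ k * Aᴴ =
      Complex.I • (piSeq A P₀ k * (piSeq A P₀ k)ᴴ) → IsStep A A⁻¹ (sSeq A S₀ P₀ k)
        (sSeq A S₀ P₀ (k + 1)) (piSeq A P₀ k) (piSeq A P₀ (k + 1)) (sigMat m₁ m₂) := fun k hk =>
    { mul_inv := mul_nonsing_inv _ hA
      inv_mul := nonsing_inv_mul _ hA
      sq := sigMat_mul_self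
      star_sig := sigMat_conjTranspose
      identity := hk
      next_P := rfl
      next_S := by rw [sSeq, conjTranspose_nonsing_inv] }
  have hid : A * sSeq A S₀ P₀ k - sSeq A S₀ P₀ k * Aᴴ =
      Complex.I • (piSeq A P₀ k * (piSeq A P₀ k)ᴴ) := by
    induction k with
    | zero => exact h.identity
    | succ k ih => exact (step k ih).identity_next
  exact ⟨hid, step k hid⟩

theorem isStep (h : StronglyAdmissible A S₀ P₀) (k : ℕ) :
    IsStep A A⁻¹ (sSeq A S₀ P₀ k) (sSeq A S₀ P₀ (k + 1)) (piSeq A P₀ k) (piSeq A P₀ (k + 1))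
      (sigMat m₁ m₂) := (h.identity_seq k).2

theorem factor_eq (h : StronglyAdmissible A S₀ P₀) :
    1 - Complex.I • A⁻¹ = A⁻¹ * (A - Complex.I • (1 : Matrix (Fin n) (Fin n) ℂ)) := by
  have hA := (Matrix.isUnit_iff_isUnit_det A).1 h.isUnit
  simp [Matrix.mul_sub, nonsing_inv_mul _ hA]

theorem isUnit_factor (h : StronglyAdmissible A S₀ P₀) : IsUnit (1 - Complex.I • A⁻¹) := by
  rw [h.factor_eq]
  exact (isUnit_nonsing_inv_iff.2 h.isUnit).mul h.isUnit_sub_I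

/-- `A⁻¹ = Q (A - i)⁻¹`. -/
theorem inv_eq (h : StronglyAdmissible A S₀ P₀) {τ : Type*} (X : Matrix (Fin n) τ ℂ) :
    A⁻¹ * ((A - Complex.I • (1 : Matrix (Fin n) (Fin n) ℂ)) * X) =
      (1 - Complex.I • A⁻¹) * X := by
  rw [h.factor_eq, Matrix.mul_assoc]

theorem sub_I_mul_inv (h : StronglyAdmissible A S₀ P₀) {τ : Type*} (X : Matrix (Fin n) τ ℂ) :
    (A - Complex.I • (1 : Matrix (Fin n) (Fin n) ℂ)) *
      ((A - Complex.I • (1 : Matrix (Fin n) (Fin n) ℂ))⁻¹ * X) = X :=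
  mul_nonsing_inv_cancel_left _ _ ((Matrix.isUnit_iff_isUnit_det _).1 h.isUnit_sub_I)

/-- `Π_k = Q^k Z_k` with `Q = 1 - i A⁻¹`. -/
theorem piSeq_eq (h : StronglyAdmissible A S₀ P₀) (k : ℕ) :
    piSeq A P₀ k = (1 - Complex.I • A⁻¹) ^ k * zSeq A P₀ k := by
  have hA := (Matrix.isUnit_iff_isUnit_det A).1 h.isUnit
  induction k with
  | zero =>
    rw [piSeq, zSeq, xSeq, h.sub_I_mul_inv, pow_zero, Matrix.one_mul, fromCols_toCols]
  | succ k ih =>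
    have hcomm : A⁻¹ * (1 - Complex.I • A⁻¹) ^ k = (1 - Complex.I • A⁻¹) ^ k * A⁻¹ :=
      (((Commute.one_right A⁻¹).sub_right ((Commute.refl A⁻¹).smul_right _)).pow_right k).eq
    have hz : (1 - Complex.I • A⁻¹) * zSeq A P₀ (k + 1) =
        zSeq A P₀ k + Complex.I • (A⁻¹ * zSeq A P₀ k * sigMat m₁ m₂) := by
      have h1 := h.inv_eq (xSeq A P₀ k)
      have h2 := h.sub_I_mul_inv (xSeq A P₀ k)
      rw [zSeq, zSeq, xSeq, Matrix.mul_add, Matrix.mul_smul, h2]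
      generalize (A - Complex.I • (1 : Matrix (Fin n) (Fin n) ℂ)) * xSeq A P₀ k = Y at h1
      simp only [sigMat, mul_fromCols, fromCols_mul_fromBlocks]
      ext i (j | j)
      · have h3 := congrFun (congrFun h1 i) j
        simp [Matrix.sub_mul, Matrix.mul_add] at h3 ⊢
        linear_combination (-2 * Complex.I) * h3
      · simp [Matrix.sub_mul]
        ring
    rw [piSeq, ih, pow_succ, Matrix.mul_assoc _ (1 - Complex.I • A⁻¹), hz, Matrix.mul_add,
      Matrix.mul_smul, ← Matrix.mul_assoc A⁻¹, hcomm]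
    simp only [Matrix.mul_assoc]

/-- `S_k = Q^k R_k Q^k*`: by `IsStep.next_S_eq` the step adds a matrix built from `Π_k (1 + j)`, in
which only the block `T^k ϑ₁` of `Z_k` survives. -/
theorem sSeq_eq (h : StronglyAdmissible A S₀ P₀) (k : ℕ) :
    sSeq A S₀ P₀ k =
      (1 - Complex.I • A⁻¹) ^ k * rSeq A S₀ P₀ k * ((1 - Complex.I • A⁻¹) ^ k)ᴴ := by
  induction k with
  | zero => simp [sSeq, rSeq]
  | succ k ih =>
    have hcomm : A⁻¹ * (1 - Complex.I • A⁻¹) ^ k = (1 - Complex.I • A⁻¹) ^ k * A⁻¹ :=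
      (((Commute.one_right A⁻¹).sub_right ((Commute.refl A⁻¹).smul_right _)).pow_right k).eq
    have hz : zSeq A P₀ k * (1 + sigMat m₁ m₂) * (zSeq A P₀ k)ᴴ = (2 : ℂ) •
        (((A - Complex.I • (1 : Matrix (Fin n) (Fin n) ℂ)) * xSeq A P₀ k) *
          ((A - Complex.I • (1 : Matrix (Fin n) (Fin n) ℂ)) * xSeq A P₀ k)ᴴ) := by
      have h1 : (1 + sigMat m₁ m₂) = fromBlocks ((2 : ℂ) • 1) 0 0 0 := by
        rw [sigMat, ← fromBlocks_one, fromBlocks_add]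
        simp [two_smul]
      rw [h1, zSeq, fromCols_mul_fromBlocks, conjTranspose_fromCols_eq_fromRows_conjTranspose,
        fromCols_mul_fromRows]
      simp
    have hx : A⁻¹ * piSeq A P₀ k * (1 + sigMat m₁ m₂) * (A⁻¹ * piSeq A P₀ k)ᴴ = (2 : ℂ) •
        (((1 - Complex.I • A⁻¹) ^ (k + 1) * xSeq A P₀ k) *
          ((1 - Complex.I • A⁻¹) ^ (k + 1) * xSeq A P₀ k)ᴴ) := by
      have h2 : (1 - Complex.I • A⁻¹) ^ (k + 1) * xSeq A P₀ k = (1 - Complex.I • A⁻¹) ^ k *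
          A⁻¹ * ((A - Complex.I • (1 : Matrix (Fin n) (Fin n) ℂ)) * xSeq A P₀ k) := by
        rw [Matrix.mul_assoc _ A⁻¹, h.inv_eq, ← Matrix.mul_assoc, ← pow_succ]
      calc _ = (1 - Complex.I • A⁻¹) ^ k * A⁻¹ * (zSeq A P₀ k * (1 + sigMat m₁ m₂) *
            (zSeq A P₀ k)ᴴ) * ((1 - Complex.I • A⁻¹) ^ k * A⁻¹)ᴴ := by
            rw [h.piSeq_eq, ← Matrix.mul_assoc A⁻¹, hcomm, conjTranspose_mul _ (zSeq A P₀ k)]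
            simp only [Matrix.mul_assoc]
        _ = _ := by
            rw [hz, h2, conjTranspose_mul ((1 - Complex.I • A⁻¹) ^ k * A⁻¹)]
            simp only [Matrix.mul_smul, Matrix.smul_mul, Matrix.mul_assoc]
    rw [(h.isStep k).next_S_eq, hx, ih, rSeq, pow_succ']
    simp only [conjTranspose_mul, Matrix.mul_add, Matrix.add_mul, Matrix.mul_smul,
      Matrix.smul_mul, Matrix.mul_assoc]

theorem rSeq_posDef (h : StronglyAdmissible A S₀ P₀) (k : ℕ) : (rSeq A S₀ P₀ k).PosDef := by
  induction k with
  | zero => exact h.posDef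
  | succ k ih => exact ih.add_posSemidef ((posSemidef_self_mul_conjTranspose _).smul zero_le_two)

theorem sSeq_posDef (h : StronglyAdmissible A S₀ P₀) (k : ℕ) : (sSeq A S₀ P₀ k).PosDef := by
  rw [h.sSeq_eq, ← star_eq_conjTranspose]
  exact (Matrix.IsUnit.posDef_star_right_conjugate_iff (h.isUnit_factor.pow k)).2 (h.rSeq_posDef k)

theorem rSeq_identity (h : StronglyAdmissible A S₀ P₀) (k : ℕ) :
    A * rSeq A S₀ P₀ k - rSeq A S₀ P₀ k * Aᴴ = Complex.I • (zSeq A P₀ k * (zSeq A P₀ k)ᴴ) := by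
  have hu := h.isUnit_factor.pow k
  have hcomm : A * (1 - Complex.I • A⁻¹) ^ k = (1 - Complex.I • A⁻¹) ^ k * A := by
    have hA := (Matrix.isUnit_iff_isUnit_det A).1 h.isUnit
    have hAA : Commute A A⁻¹ := (mul_nonsing_inv _ hA).trans (nonsing_inv_mul _ hA).symm
    exact (((Commute.one_right A).sub_right (hAA.smul_right _)).pow_right k).eq
  have hcomm' := congrArg conjTranspose hcomm
  rw [conjTranspose_mul, conjTranspose_mul] at hcomm'
  have h1 := (h.identity_seq k).1
  rw [h.sSeq_eq, h.piSeq_eq] at h1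
  set Q := (1 - Complex.I • A⁻¹) ^ k
  have hus : IsUnit Qᴴ := (isUnit_conjTranspose _).2 hu
  refine hu.mul_left_cancel (hus.mul_right_cancel ?_)
  calc Q * (A * rSeq A S₀ P₀ k - rSeq A S₀ P₀ k * Aᴴ) * Qᴴ
      = (Q * A) * rSeq A S₀ P₀ k * Qᴴ - Q * rSeq A S₀ P₀ k * (Aᴴ * Qᴴ) := by
        simp only [Matrix.mul_sub, Matrix.sub_mul, Matrix.mul_assoc]
    _ = A * (Q * rSeq A S₀ P₀ k * Qᴴ) - Q * rSeq A S₀ P₀ k * Qᴴ * Aᴴ := by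
        rw [← hcomm, ← hcomm']
        simp only [Matrix.mul_assoc]
    _ = _ := by
        rw [h1, conjTranspose_mul]
        simp only [Matrix.mul_assoc, Matrix.mul_smul, Matrix.smul_mul]

theorem isSkewDiracPotential (h : StronglyAdmissible A S₀ P₀) :
    IsSkewDiracPotential (potential A S₀ P₀) := by
  intro k
  have d : ∀ k, IsUnit (sSeq A S₀ P₀ k).det := fun k =>
    (Matrix.isUnit_iff_isUnit_det _).1 (h.sSeq_posDef k).isUnit
  have hV : ∀ k, ((sSeq A S₀ P₀ k)⁻¹)ᴴ = (sSeq A S₀ P₀ k)⁻¹ := fun k =>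
    (h.sSeq_posDef k).isHermitian.inv
  refine exists_unitary_of_involution ?_ sigMat_conjTranspose
    ((h.isStep k).potential_sq (mul_nonsing_inv _ (d k)) (nonsing_inv_mul _ (d k))
      (mul_nonsing_inv _ (d _)) (nonsing_inv_mul _ (d _)) (hV k) (hV _) rfl) sigMat_mul_self
    ((h.isStep k).potential_trace (mul_nonsing_inv _ (d k)) (nonsing_inv_mul _ (d k))
      (mul_nonsing_inv _ (d _)) (nonsing_inv_mul _ (d _)) rfl)
  simp only [IsHermitian, potential, conjTranspose_sub, conjTranspose_add, conjTranspose_mul,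
    conjTranspose_conjTranspose, hV, sigMat_conjTranspose, Matrix.mul_assoc]

end StronglyAdmissible

end Normalized

/-! ### Decay of the inverses -/

section Decay

theorem tendsto_zero_of_sum_sq {ι : Type*} [Fintype ι] {y : ℕ → ι → ℂ}
    (h : Tendsto (fun k => ∑ i, ‖y k i‖ ^ 2) atTop (𝓝 0)) : Tendsto y atTop (𝓝 0) := by
  refine tendsto_pi_nhds.2 fun i => ?_
  have h1 : Tendsto (fun k => ‖y k i‖ ^ 2) atTop (𝓝 0) :=
    squeeze_zero (fun k => by positivity)
      (fun k => Finset.single_le_sum (f := fun i => ‖y k i‖ ^ 2) (fun _ _ => by positivity)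
        (Finset.mem_univ i)) h
  have h2 := h1.sqrt
  simp only [Real.sqrt_sq (norm_nonneg _), Real.sqrt_zero] at h2
  exact tendsto_zero_iff_norm_tendsto_zero.2 h2

variable {m₁ m₂ n : ℕ} {A S₀ : Matrix (Fin n) (Fin n) ℂ}
  {P₀ : Matrix (Fin n) (Fin m₁ ⊕ Fin m₂) ℂ}

theorem xSeq_succ_conjTranspose_mulVec (A : Matrix (Fin n) (Fin n) ℂ)
    (P₀ : Matrix (Fin n) (Fin m₁ ⊕ Fin m₂) ℂ) (k : ℕ) (v : Fin n → ℂ) :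
    (xSeq A P₀ (k + 1))ᴴ *ᵥ v = (xSeq A P₀ k)ᴴ *ᵥ v - (2 * Complex.I) •
      ((xSeq A P₀ k)ᴴ *ᵥ (((A - Complex.I • (1 : Matrix (Fin n) (Fin n) ℂ))⁻¹)ᴴ *ᵥ v)) := by
  rw [xSeq, conjTranspose_add, conjTranspose_smul, conjTranspose_mul, add_mulVec, smul_mulVec,
    mulVec_mulVec]
  simp [sub_eq_add_neg]

/-- The vectors `v` with `X_k* v → 0` form a subspace invariant under `(A - i)⁻¹*`. On an
eigenvector of `A*` in it, `X_k* v` is multiplied at each step by a number of modulus at least one,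
so that `ϑ₁* v = 0`, which contradicts controllability. -/
theorem StronglyAdmissible.eq_zero_of_tendsto (h : StronglyAdmissible A S₀ P₀) {v : Fin n → ℂ}
    (hv : Tendsto (fun k => (xSeq A P₀ k)ᴴ *ᵥ v) atTop (𝓝 0)) : v = 0 := by
  set D := (A - Complex.I • (1 : Matrix (Fin n) (Fin n) ℂ))⁻¹ with hD
  let N : Submodule ℂ (Fin n → ℂ) :=
    { carrier := {v | Tendsto (fun k => (xSeq A P₀ k)ᴴ *ᵥ v) atTop (𝓝 0)}
      zero_mem' := by simp
      add_mem' := fun {a b} ha hb => by simpa [mulVec_add] using Tendsto.add ha hb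
      smul_mem' := fun c x hx => by simpa [mulVec_smul] using Tendsto.const_smul hx c }
  have hinv : ∀ x ∈ N, toLin' Dᴴ x ∈ N := by
    intro x (hx : Tendsto _ _ _)
    change Tendsto (fun k => (xSeq A P₀ k)ᴴ *ᵥ toLin' Dᴴ x) atTop (𝓝 0)
    have h1 := ((hx.sub (hx.comp (tendsto_add_atTop_nat 1))).const_smul (2 * Complex.I)⁻¹)
    rw [sub_zero, smul_zero] at h1
    refine h1.congr fun k => ?_
    simp only [Function.comp_apply]
    rw [xSeq_succ_conjTranspose_mulVec, sub_sub_cancel, smul_smul, inv_mul_cancel₀ (by simp),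
      one_smul, toLin'_apply]
  by_contra hv0
  have : Nontrivial N := ⟨⟨⟨v, hv⟩, 0, fun h0 => hv0 (congrArg Subtype.val h0)⟩⟩
  obtain ⟨g, hg⟩ := Module.End.exists_eigenvalue ((toLin' Dᴴ).restrict hinv)
  obtain ⟨⟨w, hw⟩, hwg⟩ := hg.exists_hasEigenvector
  have hDw : Dᴴ *ᵥ w = g • w := by
    have := congrArg Subtype.val hwg.apply_eq_smul
    simpa using this
  have hw0 : w ≠ 0 := fun h0 => hwg.2 (Subtype.ext h0)
  have hDu : (A - Complex.I • (1 : Matrix (Fin n) (Fin n) ℂ))ᴴ * Dᴴ = 1 := by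
    rw [← conjTranspose_mul, nonsing_inv_mul _ ((Matrix.isUnit_iff_isUnit_det _).1 h.isUnit_sub_I),
      conjTranspose_one]
  have hw1 : w = g • ((A - Complex.I • (1 : Matrix (Fin n) (Fin n) ℂ))ᴴ *ᵥ w) := by
    rw [← mulVec_smul, ← hDw, mulVec_mulVec, hDu, one_mulVec]
  have hg0 : g ≠ 0 := by
    rintro rfl
    exact hw0 (by rw [hw1, zero_smul])
  have hAw : Aᴴ *ᵥ w = (g⁻¹ - Complex.I) • w := by
    have h2 : g⁻¹ • w = (A - Complex.I • (1 : Matrix (Fin n) (Fin n) ℂ))ᴴ *ᵥ w := by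
      conv_lhs => rw [hw1]
      rw [smul_smul, inv_mul_cancel₀ hg0, one_smul]
    rw [sub_smul, h2, conjTranspose_sub, sub_mulVec, conjTranspose_smul, conjTranspose_one,
      smul_mulVec, one_mulVec]
    simp
  have him := h.im_neg hAw hw0
  have hpow : ∀ k, (xSeq A P₀ k)ᴴ *ᵥ w =
      (1 - 2 * Complex.I * g) ^ k • ((xSeq A P₀ 0)ᴴ *ᵥ w) := by
    intro k
    induction k with
    | zero => simp
    | succ k ih =>
      rw [xSeq_succ_conjTranspose_mulVec, ← hD, hDw, mulVec_smul, ih, pow_succ]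
      module
  -- `g⁻¹ - i` is an eigenvalue of `A*`, so `g⁻¹ - 2 i` is the farther of `g⁻¹ - 2 i` and `g⁻¹`
  -- from the origin, and `1 - 2 i g` is their quotient.
  have hge : 1 ≤ ‖1 - 2 * Complex.I * g‖ := by
    have h3 : ‖g⁻¹‖ ≤ ‖g⁻¹ - 2 * Complex.I‖ := by
      rw [← sq_le_sq₀ (norm_nonneg _) (norm_nonneg _), ← Complex.normSq_eq_norm_sq,
        ← Complex.normSq_eq_norm_sq, Complex.normSq_apply, Complex.normSq_apply]
      simp at him ⊢
      nlinarith
    have h4 : 1 - 2 * Complex.I * g = g * (g⁻¹ - 2 * Complex.I) := by field_simp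
    rw [h4, norm_mul]
    calc (1 : ℝ) = ‖g‖ * ‖g⁻¹‖ := by rw [← norm_mul, mul_inv_cancel₀ hg0, norm_one]
      _ ≤ _ := mul_le_mul_of_nonneg_left h3 (norm_nonneg _)
  have hx0 : (xSeq A P₀ 0)ᴴ *ᵥ w = 0 := by
    have h5 : Tendsto (fun k => ‖(xSeq A P₀ k)ᴴ *ᵥ w‖) atTop (𝓝 0) :=
      tendsto_zero_iff_norm_tendsto_zero.1
        (show Tendsto (fun k => (xSeq A P₀ k)ᴴ *ᵥ w) atTop (𝓝 0) from hw)
    have h6 : ‖(xSeq A P₀ 0)ᴴ *ᵥ w‖ ≤ 0 := by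
      refine ge_of_tendsto' h5 fun k => ?_
      rw [hpow k, norm_smul, norm_pow]
      exact le_mul_of_one_le_left (norm_nonneg _) (one_le_pow₀ hge)
    exact norm_le_zero_iff.1 h6
  refine hw0 (h.controllable.eq_zero hAw ?_)
  rw [xSeq, conjTranspose_mul, ← mulVec_mulVec, ← hD, hDw, mulVec_smul] at hx0
  exact (smul_eq_zero.1 hx0).resolve_left hg0

theorem quadForm_rSeq_succ (A S₀ : Matrix (Fin n) (Fin n) ℂ)
    (P₀ : Matrix (Fin n) (Fin m₁ ⊕ Fin m₂) ℂ) (k : ℕ) (w : Fin n → ℂ) :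
    quadForm (rSeq A S₀ P₀ (k + 1)) w =
      quadForm (rSeq A S₀ P₀ k) w + 2 * ∑ i, ‖((xSeq A P₀ k)ᴴ *ᵥ w) i‖ ^ 2 := by
  rw [← re_star_dotProduct_self, quadForm, rSeq, add_mulVec, dotProduct_add, Complex.add_re,
    smul_mulVec, dotProduct_smul, star_mulVec, conjTranspose_conjTranspose, ← mulVec_mulVec,
    dotProduct_mulVec _ (xSeq A P₀ k)]
  simp [quadForm]

theorem StronglyAdmissible.tendsto_rSeq_inv (h : StronglyAdmissible A S₀ P₀) :
    Tendsto (fun k => (rSeq A S₀ P₀ k)⁻¹) atTop (𝓝 0) := by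
  have hmono : ∀ w, Monotone fun k => quadForm (rSeq A S₀ P₀ k) w := fun w =>
    monotone_nat_of_le_succ fun k => by
      rw [quadForm_rSeq_succ]
      exact le_add_of_nonneg_right (by positivity)
  refine tendsto_inv_of_unbounded h.rSeq_posDef hmono fun w c hc => h.eq_zero_of_tendsto ?_
  -- A bounded increasing sequence has increments tending to zero.
  have hlim := tendsto_atTop_ciSup (hmono w) ⟨c, by rintro _ ⟨k, rfl⟩; exact hc k⟩
  have h1 := ((hlim.comp (tendsto_add_atTop_nat 1)).sub hlim).div_const 2
  rw [sub_self, zero_div] at h1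
  refine tendsto_zero_of_sum_sq (h1.congr fun k => ?_)
  simp only [Function.comp_apply]
  rw [quadForm_rSeq_succ]
  ring

theorem tendsto_matrix_zero_of_mul_conjTranspose {ι κ : Type*} [Fintype κ]
    {W : ℕ → Matrix ι κ ℂ} (h : Tendsto (fun k => W k * (W k)ᴴ) atTop (𝓝 0)) :
    Tendsto W atTop (𝓝 0) := by
  refine tendsto_pi_nhds.2 fun i => tendsto_zero_of_sum_sq ?_
  have h1 := tendsto_pi_nhds.1 (tendsto_pi_nhds.1 h i) i
  have h2 := (Complex.continuous_re.tendsto _).comp h1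
  refine (h2.congr fun k => ?_)
  rw [← re_star_dotProduct_self]
  simp [Matrix.mul_apply, dotProduct, mul_comm]

/-- `W_k = R_k⁻¹ Q^{-k} Π_k` tends to zero, since the operator identity for `R_k` expresses
`W_k W_k*` by `R_k⁻¹`. -/
theorem StronglyAdmissible.tendsto_rSeq_inv_mul (h : StronglyAdmissible A S₀ P₀) :
    Tendsto (fun k => (rSeq A S₀ P₀ k)⁻¹ * zSeq A P₀ k) atTop (𝓝 0) := by
  refine tendsto_matrix_zero_of_mul_conjTranspose ?_
  have h1 : Tendsto (fun k => (-Complex.I) • ((rSeq A S₀ P₀ k)⁻¹ * A - Aᴴ * (rSeq A S₀ P₀ k)⁻¹))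
      atTop (𝓝 0) := by
    have hc : Continuous fun X : Matrix (Fin n) (Fin n) ℂ => (-Complex.I) • (X * A - Aᴴ * X) := by
      fun_prop
    have := (hc.tendsto 0).comp h.tendsto_rSeq_inv
    simpa [Function.comp_def] using this
  refine h1.congr fun k => ?_
  have hd := (Matrix.isUnit_iff_isUnit_det _).1 (h.rSeq_posDef k).isUnit
  have hV : ((rSeq A S₀ P₀ k)⁻¹)ᴴ = (rSeq A S₀ P₀ k)⁻¹ := (h.rSeq_posDef k).isHermitian.inv
  have h2 : (rSeq A S₀ P₀ k)⁻¹ * (A * rSeq A S₀ P₀ k - rSeq A S₀ P₀ k * Aᴴ) *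
      (rSeq A S₀ P₀ k)⁻¹ = (rSeq A S₀ P₀ k)⁻¹ *
        (Complex.I • (zSeq A P₀ k * (zSeq A P₀ k)ᴴ)) * (rSeq A S₀ P₀ k)⁻¹ := by
    rw [h.rSeq_identity]
  rw [Matrix.mul_sub, Matrix.sub_mul, ← Matrix.mul_assoc _ A, Matrix.mul_assoc _ _ (_)⁻¹,
    mul_nonsing_inv _ hd, Matrix.mul_one, nonsing_inv_mul_cancel_left _ _ hd] at h2
  rw [h2, conjTranspose_mul, hV, Matrix.mul_smul, Matrix.smul_mul, smul_smul]
  simp [Matrix.mul_assoc]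

end Decay

/-! ### Uniqueness of the Jost solution -/

section Uniqueness

variable {m₁ m₂ : ℕ}

/-- The squared Frobenius norm. -/
def energy {ι κ : Type*} [Fintype ι] [Fintype κ] (Y : Matrix ι κ ℂ) : ℝ := (Yᴴ * Y).trace.re

theorem energy_eq {ι κ : Type*} [Fintype ι] [Fintype κ] (Y : Matrix ι κ ℂ) :
    energy Y = ∑ j, ∑ i, ‖Y i j‖ ^ 2 := by
  simp [energy, Matrix.trace, Matrix.mul_apply, ← Complex.normSq_eq_norm_sq, Complex.normSq_apply]

theorem energy_nonneg {ι κ : Type*} [Fintype ι] [Fintype κ] (Y : Matrix ι κ ℂ) : 0 ≤ energy Y := by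
  rw [energy_eq]
  positivity

theorem energy_smul {ι κ : Type*} [Fintype ι] [Fintype κ] (c : ℂ) (Y : Matrix ι κ ℂ) :
    energy (c • Y) = ‖c‖ ^ 2 * energy Y := by
  simp [energy_eq, mul_pow, Finset.mul_sum]

theorem eq_zero_of_energy {ι κ : Type*} [Fintype ι] [Fintype κ] {Y : Matrix ι κ ℂ}
    (h : energy Y ≤ 0) : Y = 0 := by
  have h1 := le_antisymm h (energy_nonneg Y)
  rw [energy_eq, Finset.sum_eq_zero_iff_of_nonneg fun _ _ => by positivity] at h1
  ext i j
  have h2 := h1 j (Finset.mem_univ _)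
  rw [Finset.sum_eq_zero_iff_of_nonneg fun _ _ => by positivity] at h2
  simpa using h2 i (Finset.mem_univ _)

variable {ι κ : Type*} [Fintype ι] [DecidableEq ι] [Fintype κ]

theorem energy_step {C : Matrix ι ι ℂ} (hC : Cᴴ = C) (hsq : C * C = 1) (a : ℂ)
    (Y : Matrix ι κ ℂ) : energy ((1 + a • C) * Y) =
      (1 + ‖a‖ ^ 2) * energy Y + 2 * a.re * (Yᴴ * C * Y).trace.re := by
  have hc : ∀ X : Matrix ι κ ℂ, C * (C * X) = X := fun X => by
    rw [← Matrix.mul_assoc, hsq, Matrix.one_mul]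
  have h1 : ((1 + a • C) * Y)ᴴ * ((1 + a • C) * Y) =
      (1 + star a * a) • (Yᴴ * Y) + (a + star a) • (Yᴴ * C * Y) := by
    simp only [conjTranspose_mul, conjTranspose_add, conjTranspose_smul, hC,
      Matrix.mul_add, Matrix.add_mul, Matrix.mul_assoc, Matrix.one_mul, Matrix.smul_mul,
      Matrix.mul_smul, hc]
    module
  rw [energy, h1, trace_add, trace_smul, trace_smul, Complex.star_def,
    ← Complex.normSq_eq_conj_mul_self,
    Complex.add_conj, Complex.normSq_eq_norm_sq, energy, smul_eq_mul, smul_eq_mul, Complex.add_re,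
    Complex.re_ofReal_mul, ← Complex.ofReal_one, ← Complex.ofReal_add, Complex.re_ofReal_mul]

/-- For `Re a ≥ 0` and a Hermitian involution `C` the matrix `1 + a C` is bounded below by
`|1 - a|`, the modulus of its eigenvalue `1 - a`. -/
theorem energy_step_ge {C : Matrix ι ι ℂ} (hC : Cᴴ = C) (hsq : C * C = 1) {a : ℂ}
    (ha : 0 ≤ a.re) (Y : Matrix ι κ ℂ) :
    ‖1 - a‖ ^ 2 * energy Y ≤ energy ((1 + a • C) * Y) := by
  -- The case `a = 1` of `energy_step` bounds the indefinite term `Y* C Y` from below.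
  have h1 := energy_nonneg ((1 + (1 : ℂ) • C) * Y)
  rw [energy_step hC hsq] at h1 ⊢
  simp only [norm_one, Complex.one_re] at h1
  have h2 : ‖1 - a‖ ^ 2 = 1 + ‖a‖ ^ 2 - 2 * a.re := by
    rw [← Complex.normSq_eq_norm_sq, ← Complex.normSq_eq_norm_sq, Complex.normSq_apply,
      Complex.normSq_apply]
    simp
    ring
  rw [h2]
  nlinarith [mul_nonneg ha (show 0 ≤ energy Y + (Yᴴ * C * Y).trace.re by linarith)]

/-- A Jost solution is unique, because no nonzero solution decays faster than `(1 - i/z)^k` when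
`Im z ≥ 0`. -/
theorem IsJostSolution.unique {C : ℕ → Matrix (Fin m₁ ⊕ Fin m₂) (Fin m₁ ⊕ Fin m₂) ℂ}
    (hC : IsSkewDiracPotential C) {z : ℂ} (hz : 0 ≤ z.im) (hz0 : z ≠ 0) (hzI : z ≠ Complex.I)
    {Y Y' : ℕ → Matrix (Fin m₁ ⊕ Fin m₂) (Fin m₂) ℂ}
    (hY : IsJostSolution C z Y) (hY' : IsJostSolution C z Y') : Y = Y' := by
  have hCC : ∀ k, (C k)ᴴ = C k ∧ C k * C k = 1 := by
    intro k
    obtain ⟨U, hU, hk⟩ := hC k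
    have hU' : U * Uᴴ = 1 := mem_unitaryGroup_iff.1 hU
    have hU'' : Uᴴ * U = 1 := mem_unitaryGroup_iff'.1 hU
    rw [hk]
    refine ⟨by simp [conjTranspose_mul, sigMat_conjTranspose, Matrix.mul_assoc], ?_⟩
    calc Uᴴ * sigMat m₁ m₂ * U * (Uᴴ * sigMat m₁ m₂ * U)
        = Uᴴ * sigMat m₁ m₂ * (U * Uᴴ) * sigMat m₁ m₂ * U := by simp only [Matrix.mul_assoc]
      _ = 1 := by
        rw [hU', Matrix.mul_one, Matrix.mul_assoc Uᴴ, sigMat_mul_self, Matrix.mul_one, hU'']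
  have ha : 0 ≤ (Complex.I / z).re := by
    have h1 : (Complex.I / z).re = z.im / Complex.normSq z := by simp [Complex.div_re]
    rw [h1]
    exact div_nonneg hz (Complex.normSq_nonneg z)
  have hne : 1 - Complex.I / z ≠ 0 := by
    rw [sub_ne_zero]
    intro h
    rw [eq_div_iff hz0, one_mul] at h
    exact hzI h
  obtain ⟨ε, hε, hYε⟩ := hY.asymptotics
  obtain ⟨ε', hε', hYε'⟩ := hY'.asymptotics
  have hsys : ∀ k, Y (k + 1) - Y' (k + 1) =
      (1 + (Complex.I / z) • C k) * (Y k - Y' k) := fun k => by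
    rw [hY.system, hY'.system, Matrix.mul_sub]
  have hlow : ∀ k, (‖1 - Complex.I / z‖ ^ 2) ^ k * energy (Y 0 - Y' 0) ≤ energy (Y k - Y' k) := by
    intro k
    induction k with
    | zero => simp
    | succ k ih =>
      rw [hsys, pow_succ', mul_assoc]
      exact (mul_le_mul_of_nonneg_left ih (by positivity)).trans
        (energy_step_ge (hCC k).1 (hCC k).2 ha _)
  have hle : ∀ k, energy (Y 0 - Y' 0) ≤ energy (ε k - ε' k) := by
    intro k
    have h1 := hlow k
    rw [hYε k, hYε' k, ← smul_sub, add_sub_add_left_eq_sub, energy_smul, norm_pow, ← pow_mul,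
      ← pow_mul, mul_comm k 2] at h1
    exact le_of_mul_le_mul_left h1 (by positivity)
  have hlim : Tendsto (fun k => energy (ε k - ε' k)) atTop (𝓝 0) := by
    have hc : Continuous (energy : Matrix (Fin m₁ ⊕ Fin m₂) (Fin m₂) ℂ → ℝ) := by
      unfold energy
      fun_prop
    have := (hc.tendsto _).comp (hε.sub hε')
    simpa [Function.comp_def, energy] using this
  have h0 : Y 0 - Y' 0 = 0 := eq_zero_of_energy (ge_of_tendsto' hlim hle)
  have hall : ∀ k, Y k - Y' k = 0 := by
    intro k
    induction k with
    | zero => exact h0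
    | succ k ih => rw [hsys, ih, Matrix.mul_zero]
  exact funext fun k => sub_eq_zero.1 (hall k)

end Uniqueness

/-! ### Existence of the Jost solution -/

section Jost

variable {m₁ m₂ n : ℕ}

/-- The Jost solution `(1 - i/z)^k (1 - i Π_k* S_k⁻¹ (A + z)⁻¹ Π_k) [0; 1]` given by the Darboux
matrix. -/
def jostSeq (A S₀ : Matrix (Fin n) (Fin n) ℂ) (P₀ : Matrix (Fin n) (Fin m₁ ⊕ Fin m₂) ℂ) (z : ℂ)
    (k : ℕ) : Matrix (Fin m₁ ⊕ Fin m₂) (Fin m₂) ℂ :=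
  (1 - Complex.I / z) ^ k • ((1 - Complex.I • ((piSeq A P₀ k)ᴴ * (sSeq A S₀ P₀ k)⁻¹ *
    (A + z • (1 : Matrix (Fin n) (Fin n) ℂ))⁻¹ * piSeq A P₀ k)) *
      (fromRows 0 1 : Matrix (Fin m₁ ⊕ Fin m₂) (Fin m₂) ℂ))

variable {A S₀ : Matrix (Fin n) (Fin n) ℂ} {P₀ : Matrix (Fin n) (Fin m₁ ⊕ Fin m₂) ℂ}

theorem mul_fromRows_zero_one (P : Matrix (Fin n) (Fin m₁ ⊕ Fin m₂) ℂ) :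
    P * (fromRows 0 1 : Matrix (Fin m₁ ⊕ Fin m₂) (Fin m₂) ℂ) = P.toCols₂ := by
  conv_lhs => rw [← fromCols_toCols P]
  rw [fromCols_mul_fromRows, Matrix.mul_zero, Matrix.mul_one, zero_add]

/-- The deviation of the Darboux matrix from `1` on `[0; 1]`, in terms of the normalized sequences:
the powers of `Q` cancel because `Q` commutes with `A + z`. -/
theorem StronglyAdmissible.darboux_remainder (h : StronglyAdmissible A S₀ P₀) {z : ℂ}
    (hz : 0 ≤ z.im) (k : ℕ) :
    (piSeq A P₀ k)ᴴ * (sSeq A S₀ P₀ k)⁻¹ * (A + z • (1 : Matrix (Fin n) (Fin n) ℂ))⁻¹ *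
        piSeq A P₀ k * (fromRows 0 1 : Matrix (Fin m₁ ⊕ Fin m₂) (Fin m₂) ℂ) =
      ((rSeq A S₀ P₀ k)⁻¹ * zSeq A P₀ k)ᴴ *
        ((A + z • (1 : Matrix (Fin n) (Fin n) ℂ))⁻¹ * P₀.toCols₂) := by
  have hA := (Matrix.isUnit_iff_isUnit_det A).1 h.isUnit
  have hN := (Matrix.isUnit_iff_isUnit_det _).1 (h.isUnit_add_smul hz)
  have hQ := (Matrix.isUnit_iff_isUnit_det _).1 (h.isUnit_factor.pow k)
  have hV : ((rSeq A S₀ P₀ k)⁻¹)ᴴ = (rSeq A S₀ P₀ k)⁻¹ := (h.rSeq_posDef k).isHermitian.inv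
  have hAA : Commute A A⁻¹ := (mul_nonsing_inv _ hA).trans (nonsing_inv_mul _ hA).symm
  have hNQ : Commute (A + z • (1 : Matrix (Fin n) (Fin n) ℂ)) ((1 - Complex.I • A⁻¹) ^ k) := by
    refine Commute.pow_right ?_ k
    refine Commute.add_left ?_ ((Commute.one_left _).smul_left z)
    exact (Commute.one_right A).sub_right (hAA.smul_right _)
  rw [h.sSeq_eq, h.piSeq_eq]
  set Q := (1 - Complex.I • A⁻¹) ^ k
  set N := A + z • (1 : Matrix (Fin n) (Fin n) ℂ)
  have hMQ : N⁻¹ * Q = Q * N⁻¹ := by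
    have h1 : N⁻¹ * (N * Q) * N⁻¹ = N⁻¹ * (Q * N) * N⁻¹ := by rw [hNQ.eq]
    rw [nonsing_inv_mul_cancel_left _ _ hN, Matrix.mul_assoc, Matrix.mul_assoc,
      mul_nonsing_inv _ hN, Matrix.mul_one] at h1
    exact h1.symm
  have hQs : IsUnit (Qᴴ).det := by rw [det_conjTranspose]; exact hQ.star
  have hz2 : (zSeq A P₀ k).toCols₂ = P₀.toCols₂ := by simp [zSeq]
  rw [Matrix.mul_inv_rev, Matrix.mul_inv_rev]
  calc _ = (zSeq A P₀ k)ᴴ * (Qᴴ * ((Qᴴ)⁻¹ * ((rSeq A S₀ P₀ k)⁻¹ * (Q⁻¹ * ((N⁻¹ * Q) *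
          (zSeq A P₀ k * (fromRows 0 1 : Matrix (Fin m₁ ⊕ Fin m₂) (Fin m₂) ℂ))))))) := by
        simp only [conjTranspose_mul, Matrix.mul_assoc]
    _ = _ := by
        rw [mul_nonsing_inv_cancel_left _ _ hQs, hMQ, Matrix.mul_assoc Q,
          nonsing_inv_mul_cancel_left _ _ hQ, mul_fromRows_zero_one, hz2, conjTranspose_mul, hV,
          Matrix.mul_assoc]

theorem StronglyAdmissible.isJostSolution (h : StronglyAdmissible A S₀ P₀) {z : ℂ}
    (hz : 0 ≤ z.im) (hz0 : z ≠ 0) :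
    IsJostSolution (potential A S₀ P₀) z (jostSeq A S₀ P₀ z) := by
  have hN := (Matrix.isUnit_iff_isUnit_det _).1 (h.isUnit_add_smul hz)
  have d : ∀ k, IsUnit (sSeq A S₀ P₀ k).det := fun k =>
    (Matrix.isUnit_iff_isUnit_det _).1 (h.sSeq_posDef k).isUnit
  refine ⟨fun k => ?_, fun k => -Complex.I • (((rSeq A S₀ P₀ k)⁻¹ * zSeq A P₀ k)ᴴ *
        ((A + z • (1 : Matrix (Fin n) (Fin n) ℂ))⁻¹ * P₀.toCols₂)), ?_, fun k => ?_⟩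
  · have h1 := (h.isStep k).darboux (mul_nonsing_inv _ (d k)) (nonsing_inv_mul _ (d k))
      (nonsing_inv_mul _ (d (k + 1))) (C := potential A S₀ P₀ k) rfl hz0 (nonsing_inv_mul _ hN)
      (mul_nonsing_inv _ hN)
    have h2 : (1 + (Complex.I / z) • sigMat m₁ m₂) *
        (fromRows 0 1 : Matrix (Fin m₁ ⊕ Fin m₂) (Fin m₂) ℂ) =
          (1 - Complex.I / z) • fromRows 0 1 := by
      ext (i | i) j <;>
        simp [sigMat, Matrix.add_mul, fromBlocks_mul_fromRows, sub_mul]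
      ring
    rw [jostSeq, jostSeq, Matrix.mul_smul, ← Matrix.mul_assoc, ← h1,
      Matrix.mul_assoc _ _ (fromRows 0 1), h2, Matrix.mul_smul, smul_smul, pow_succ]
  · have hc : Continuous fun X : Matrix (Fin n) (Fin m₁ ⊕ Fin m₂) ℂ => -Complex.I • (Xᴴ *
        ((A + z • (1 : Matrix (Fin n) (Fin n) ℂ))⁻¹ * P₀.toCols₂)) := by fun_prop
    have := (hc.tendsto 0).comp h.tendsto_rSeq_inv_mul
    simpa [Function.comp_def] using this
  · rw [jostSeq, Matrix.sub_mul, Matrix.one_mul, Matrix.smul_mul, h.darboux_remainder hz]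
    simp only [neg_smul, sub_eq_add_neg]

end Jost

/-! ### The reflection coefficient -/

section Reflection

variable {m₁ m₂ n : ℕ} {A S₀ : Matrix (Fin n) (Fin n) ℂ} {P₀ : Matrix (Fin n) (Fin m₁ ⊕ Fin m₂) ℂ}

theorem jostSeq_zero (A S₀ : Matrix (Fin n) (Fin n) ℂ) (P₀ : Matrix (Fin n) (Fin m₁ ⊕ Fin m₂) ℂ)
    (z : ℂ) : jostSeq A S₀ P₀ z 0 = fromRows
      (-Complex.I • (P₀.toCols₁ᴴ * S₀⁻¹ * (A + z • (1 : Matrix (Fin n) (Fin n) ℂ))⁻¹ * P₀.toCols₂))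
      (1 - (P₀.toCols₂ᴴ * S₀⁻¹ * (A + z • (1 : Matrix (Fin n) (Fin n) ℂ))⁻¹) *
        (Complex.I • P₀.toCols₂)) := by
  have h1 : P₀ᴴ = fromRows P₀.toCols₁ᴴ P₀.toCols₂ᴴ := by
    conv_lhs => rw [← fromCols_toCols P₀]
    rw [conjTranspose_fromCols_eq_fromRows_conjTranspose]
  rw [jostSeq, pow_zero, one_smul, Matrix.sub_mul, Matrix.one_mul, Matrix.smul_mul, piSeq, sSeq,
    Matrix.mul_assoc _ P₀, mul_fromRows_zero_one, h1, fromRows_mul, fromRows_mul, fromRows_mul]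
  ext (i | i) j <;> simp

/-- `(z + A^×) (A + z)⁻¹ ϑ₂ = ϑ₂ [0 1] Y₀` for the Jost solution `Y`. -/
theorem crossMat_mul {z : ℂ}
    (hN : IsUnit (A + z • (1 : Matrix (Fin n) (Fin n) ℂ)).det) :
    (z • (1 : Matrix (Fin n) (Fin n) ℂ) + crossMat A S₀ P₀) *
        ((A + z • (1 : Matrix (Fin n) (Fin n) ℂ))⁻¹ * P₀.toCols₂) =
      P₀.toCols₂ * (jostSeq A S₀ P₀ z 0).toRows₂ := by
  have h1 : z • (1 : Matrix (Fin n) (Fin n) ℂ) + crossMat A S₀ P₀ =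
      (A + z • (1 : Matrix (Fin n) (Fin n) ℂ)) -
        Complex.I • (P₀.toCols₂ * P₀.toCols₂ᴴ * S₀⁻¹) := by
    rw [crossMat]; abel
  rw [h1, jostSeq_zero, toRows₂_fromRows, Matrix.sub_mul, mul_nonsing_inv_cancel_left _ _ hN,
    Matrix.mul_sub, Matrix.mul_one]
  simp only [Matrix.mul_assoc, Matrix.smul_mul, Matrix.mul_smul]

theorem isUnit_jostSeq_iff {z : ℂ}
    (hN : IsUnit (A + z • (1 : Matrix (Fin n) (Fin n) ℂ)).det) :
    IsUnit (jostSeq A S₀ P₀ z 0).toRows₂ ↔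
      IsUnit (z • (1 : Matrix (Fin n) (Fin n) ℂ) + crossMat A S₀ P₀) := by
  have h1 : z • (1 : Matrix (Fin n) (Fin n) ℂ) + crossMat A S₀ P₀ =
      (1 - (Complex.I • P₀.toCols₂) * (P₀.toCols₂ᴴ * S₀⁻¹ *
        (A + z • (1 : Matrix (Fin n) (Fin n) ℂ))⁻¹)) *
          (A + z • (1 : Matrix (Fin n) (Fin n) ℂ)) := by
    rw [Matrix.sub_mul, Matrix.one_mul, Matrix.mul_assoc, nonsing_inv_mul_cancel_right _ _ hN,
      crossMat, Matrix.smul_mul, Matrix.mul_assoc]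
    abel
  rw [h1, Matrix.isUnit_iff_isUnit_det, Matrix.isUnit_iff_isUnit_det, det_mul,
    ← det_one_sub_mul_comm, jostSeq_zero, toRows₂_fromRows, IsUnit.mul_iff]
  exact (and_iff_left hN).symm

theorem reflection_jostSeq {z : ℂ}
    (hN : IsUnit (A + z • (1 : Matrix (Fin n) (Fin n) ℂ)).det)
    (hu : IsUnit (jostSeq A S₀ P₀ z 0).toRows₂) :
    reflection (jostSeq A S₀ P₀ z 0) = (-Complex.I) • (P₀.toCols₁ᴴ * S₀⁻¹ *
      (z • (1 : Matrix (Fin n) (Fin n) ℂ) + crossMat A S₀ P₀)⁻¹ * P₀.toCols₂) := by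
  have hX := (Matrix.isUnit_iff_isUnit_det _).1 ((isUnit_jostSeq_iff hN).1 hu)
  have hd := (Matrix.isUnit_iff_isUnit_det _).1 hu
  have h1 : (A + z • (1 : Matrix (Fin n) (Fin n) ℂ))⁻¹ * P₀.toCols₂ *
      ((jostSeq A S₀ P₀ z 0).toRows₂)⁻¹ =
        (z • (1 : Matrix (Fin n) (Fin n) ℂ) + crossMat A S₀ P₀)⁻¹ * P₀.toCols₂ := by
    have h2 := congrArg (fun X => (z • (1 : Matrix (Fin n) (Fin n) ℂ) + crossMat A S₀ P₀)⁻¹ * X *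
      ((jostSeq A S₀ P₀ z 0).toRows₂)⁻¹) (crossMat_mul (S₀ := S₀) (P₀ := P₀) hN)
    simp only [nonsing_inv_mul_cancel_left _ _ hX] at h2
    rw [h2, Matrix.mul_assoc, Matrix.mul_assoc, mul_nonsing_inv _ hd, Matrix.mul_one]
  have h3 : (jostSeq A S₀ P₀ z 0).toRows₁ = -Complex.I • (P₀.toCols₁ᴴ * S₀⁻¹ *
      ((A + z • (1 : Matrix (Fin n) (Fin n) ℂ))⁻¹ * P₀.toCols₂)) := by
    rw [jostSeq_zero, toRows₁_fromRows, Matrix.mul_assoc (P₀.toCols₁ᴴ * S₀⁻¹)]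
  rw [reflection, h3, Matrix.smul_mul, Matrix.mul_assoc (P₀.toCols₁ᴴ * S₀⁻¹), h1]
  simp only [Matrix.mul_assoc]

end Reflection

end SkewDirac

end

theorem corollary3p4 {m₁ m₂ n : ℕ} (A S₀ : Matrix (Fin n) (Fin n) ℂ)
    (P₀ : Matrix (Fin n) (Fin m₁ ⊕ Fin m₂) ℂ)
    (h : SkewDirac.StronglyAdmissible A S₀ P₀) :
    -- the potential is well defined and is that of a skew-self-adjoint Dirac system
    A.det ≠ 0 ∧ (∀ k, (SkewDirac.sSeq A S₀ P₀ k).PosDef) ∧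
    SkewDirac.IsSkewDiracPotential (SkewDirac.potential A S₀ P₀) ∧
    ∀ z : ℂ, 0 ≤ z.im → z ≠ 0 → z ≠ Complex.I →
      -- the Jost solution exists and is unique
      (∃! Y : ℕ → Matrix (Fin m₁ ⊕ Fin m₂) (Fin m₂) ℂ,
        SkewDirac.IsJostSolution (SkewDirac.potential A S₀ P₀) z Y) ∧
      ∀ Y : ℕ → Matrix (Fin m₁ ⊕ Fin m₂) (Fin m₂) ℂ,
        SkewDirac.IsJostSolution (SkewDirac.potential A S₀ P₀) z Y →
        -- where the reflection coefficient is defined, and its value there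
        (IsUnit (Y 0).toRows₂ ↔
          IsUnit (z • (1 : Matrix (Fin n) (Fin n) ℂ) + SkewDirac.crossMat A S₀ P₀)) ∧
        (IsUnit (Y 0).toRows₂ →
          SkewDirac.reflection (Y 0) =
            (-Complex.I) • (P₀.toCols₁ᴴ * S₀⁻¹ *
              (z • (1 : Matrix (Fin n) (Fin n) ℂ) + SkewDirac.crossMat A S₀ P₀)⁻¹ *
              P₀.toCols₂)) := by
  refine ⟨((Matrix.isUnit_iff_isUnit_det A).1 h.isUnit).ne_zero, h.sSeq_posDef,
    h.isSkewDiracPotential, fun z hz hz0 hzI => ?_⟩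
  have hN := (Matrix.isUnit_iff_isUnit_det _).1 (h.isUnit_add_smul hz)
  have huniq := fun Y (hY : SkewDirac.IsJostSolution (SkewDirac.potential A S₀ P₀) z Y) =>
    hY.unique h.isSkewDiracPotential hz hz0 hzI (h.isJostSolution hz hz0)
  refine ⟨⟨_, h.isJostSolution hz hz0, huniq⟩, fun Y hY => ?_⟩
  rw [huniq Y hY]
  exact ⟨SkewDirac.isUnit_jostSeq_iff hN, SkewDirac.reflection_jostSeq hN⟩
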